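/- Let $0<r_1<r_2$ and let $0\le u_0\in L^1(\mathbb R^2)\cap L^\infty(\mathbb R^2)$ be such that $u_0(x)=u_0(|x|)$ is radial and monotone decreasing (i.e. non-increasing) on $|x|\ge r_1$, and $$\operatorname*{ess\,inf}_{\overline B_{r_1}(0)}u_0\ \ge\ \operatorname*{ess\,sup}_{\mathbb R^2\setminus B_{r_2}(0)}u_0 .$$ Put $T=\frac1{4\pi}\int_{\mathbb R^2}u_0\,dx$ and let $u$ be the maximal solution of $$u_t=\Delta\log u,\quad u>0\quad\text{in }\mathbb R^2\times(0,T),\qquad u(x,0)=u_0(x)\quad\text{in }\mathbb R^2,$$ that is, $u$ is a classical ($C^{2,1}$) solution, $u(\cdot,t)\to u_0$ in $L^1_{\mathrm{loc}}(\mathbb R^2)$ as $t\to0^+$, and $u$ satisfies $$\int_{\mathbb R^2}u(x,t)\,dx=\int_{\mathbb R^2}u_0\,dx-4\pi t\qquad\text{for all }0<t<T .$$ Then $$u(x,t)\ge u(y,t)\qquad\text{for all }t\in(0,T)\text{ and all }x,y\in\mathbb R^2\text{ with }|y|\ge|x|+2r_2 .$$ Consequently, for every $t\in(0,T)$ there is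 $x_t\in\overline B_{2r_2}(0)$ with $u(x_t,t)=\max_{x\in\mathbb R^2}u(x,t)$. -/

import Mathlib

open Set MeasureTheory Filter Topology

noncomputable section

namespace LogDiffusion

/-- The Euclidean plane. -/
abbrev Plane : Type := EuclideanSpace ℝ (Fin 2)

/-- `u` (written `u x t`) is a positive classical (that is, `C^{2,1}`) solution of
`u_t = Δ log u` in `ℝ² × (0,T)`; the Laplacian acts on the space variable only.
Values of `u x t` for `t ∉ (0,T)` play no role. -/
structure IsClassicalSolution (u : Plane → ℝ → ℝ) (T : ℝ) : Prop where
  pos : ∀ x : Plane, ∀ t ∈ Ioo (0 : ℝ) T, 0 < u x t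
  contDiff_space : ∀ t ∈ Ioo (0 : ℝ) T, ContDiff ℝ 2 (fun x : Plane => u x t)
  differentiableAt_time : ∀ x : Plane, ∀ t ∈ Ioo (0 : ℝ) T, DifferentiableAt ℝ (fun s => u x s) t
  continuousOn : ContinuousOn (fun p : Plane × ℝ => u p.1 p.2) (univ ×ˢ Ioo (0 : ℝ) T)
  continuousOn_fderiv :
    ContinuousOn (fun p : Plane × ℝ => fderiv ℝ (fun x : Plane => u x p.2) p.1)
      (univ ×ˢ Ioo (0 : ℝ) T)
  continuousOn_fderiv_fderiv :
    ContinuousOn (fun p : Plane × ℝ => fderiv ℝ (fderiv ℝ (fun x : Plane => u x p.2)) p.1)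
      (univ ×ˢ Ioo (0 : ℝ) T)
  continuousOn_deriv :
    ContinuousOn (fun p : Plane × ℝ => deriv (fun s => u p.1 s) p.2) (univ ×ˢ Ioo (0 : ℝ) T)
  equation : ∀ x : Plane, ∀ t ∈ Ioo (0 : ℝ) T,
    deriv (fun s => u x s) t = Laplacian.laplacian (fun y : Plane => Real.log (u y t)) x

/-- `u(·,0) = u₀`, in the sense that `u(·,t) → u₀` in `L¹_loc(ℝ²)` as `t ↓ 0`. -/
def HasInitialValue (u : Plane → ℝ → ℝ) (u₀ : Plane → ℝ) : Prop :=
  ∀ K : Set Plane, IsCompact K →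
    Tendsto (fun t : ℝ => eLpNorm (fun x => u x t - u₀ x) 1 (volume.restrict K)) (𝓝[>] 0) (𝓝 0)

/-- The mass loss law `∫ u(x,t) dx = ∫ u₀ dx - 2π ∫₀ᵗ f(s) ds` for `0 < t < T`
(including the finiteness of the mass at each time). -/
def SatisfiesMassLoss (u : Plane → ℝ → ℝ) (u₀ : Plane → ℝ) (f : ℝ → ℝ) (T : ℝ) : Prop :=
  ∀ t ∈ Ioo (0 : ℝ) T, Integrable (fun x : Plane => u x t) ∧
    ∫ x : Plane, u x t = (∫ x : Plane, u₀ x) - 2 * Real.pi * ∫ s in (0 : ℝ)..t, f s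

/-- The maximal solution of `u_t = Δ log u`, `u > 0`, `u(·,0) = u₀` with finite mass, up to its
extinction time `T = (1/4π) ∫ u₀`: it is the solution whose mass is lost at the rate given by
`f ≡ 2`. -/
structure IsMaximalSolution (u : Plane → ℝ → ℝ) (u₀ : Plane → ℝ) (T : ℝ) : Prop where
  classical : IsClassicalSolution u T
  initial : HasInitialValue u u₀
  massLoss : SatisfiesMassLoss u u₀ (fun _ => 2) T
  extinction : T = 1 / (4 * Real.pi) * ∫ x : Plane, u₀ x

/-- `u₀(x) = u₀(|x|)` is radial and monotone decreasing (in the weak sense) on `|x| ≥ r₁`. -/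
def IsRadialDecreasingFrom (u₀ : Plane → ℝ) (r₁ : ℝ) : Prop :=
  ∃ φ : ℝ → ℝ, AntitoneOn φ (Ici r₁) ∧ ∀ x : Plane, r₁ ≤ ‖x‖ → u₀ x = φ ‖x‖

end LogDiffusion

end

/-!
Given `x`, `y` with `‖x‖ + 2 r₂ ≤ ‖y‖`, compare `u` with its reflection `v` in the perpendicular
bisector of `x` and `y`, on the half-plane `H` of points closer to `x`. There `v₀ ≤ u₀`: reflecting
a point of `H` does not decrease its norm and takes it outside the ball of radius `r₂`. As
`v = u` on `∂H`, Kato's inequality for `(log v - log u)₊` shows that `∫_H (v - u)₊` is nonincreasing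
in time, up to the error of testing with a cutoff, and it tends to `0` as `t ↓ 0`.

The error is controlled by the mass loss law. Test the equation for `u` with cutoffs that are
functions of `log ‖x‖ / N`. As mass is lost exactly at the rate `4π`, the mean of `log (u ‖x‖²)`
over the annuli where the slope of the cutoffs changes is `o(N)`; so is that of its positive part,
by `log s ≤ s` and the integrability of `u`, hence that of `|log (u ‖x‖²)|`, and the cutoff error
vanishes as `N → ∞`.
-/

namespace LogDiffusion

open InnerProductSpace Laplacian
open Real (smoothTransition)

/-! ### A smooth convex ramp -/

lemma hasDerivAt_smoothTransition (x : ℝ) :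
    HasDerivAt smoothTransition (deriv smoothTransition x) x :=
  ((smoothTransition.contDiff (n := 1)).differentiable one_ne_zero x).hasDerivAt

lemma continuous_deriv_smoothTransition : Continuous (deriv smoothTransition) :=
  (smoothTransition.contDiff (n := 1)).continuous_deriv_one

lemma deriv_smoothTransition_nonneg (x : ℝ) : 0 ≤ deriv smoothTransition x :=
  smoothTransition.monotone.deriv_nonneg

lemma deriv_smoothTransition_of_nonpos {x : ℝ} (hx : x ≤ 0) : deriv smoothTransition x = 0 :=
  IsLocalMin.deriv_eq_zero <| .of_forall fun y => by
    simpa only [smoothTransition.zero_of_nonpos hx] using smoothTransition.nonneg y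

lemma deriv_smoothTransition_of_one_le {x : ℝ} (hx : 1 ≤ x) : deriv smoothTransition x = 0 :=
  IsLocalMax.deriv_eq_zero <| .of_forall fun y => by
    simpa only [smoothTransition.one_of_one_le hx] using smoothTransition.le_one y

lemma hasCompactSupport_deriv_smoothTransition : HasCompactSupport (deriv smoothTransition) :=
  .intro (isCompact_Icc (a := 0) (b := 1)) fun x hx => by
    rcases lt_or_ge x 0 with h | h
    · exact deriv_smoothTransition_of_nonpos h.le
    · exact deriv_smoothTransition_of_one_le (not_le.1 fun h' => hx ⟨h, h'⟩).le

lemma exists_deriv_smoothTransition_le : ∃ B, ∀ x, deriv smoothTransition x ≤ B :=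
  have ⟨B, hB⟩ := hasCompactSupport_deriv_smoothTransition.exists_bound_of_continuous
    continuous_deriv_smoothTransition
  ⟨B, fun x => (le_abs_self _).trans (hB x)⟩

lemma integral_deriv_smoothTransition : ∫ x, deriv smoothTransition x = 1 := by
  have hbot : Tendsto smoothTransition atBot (𝓝 0) :=
    tendsto_const_nhds.congr' <| (eventually_le_atBot 0).mono fun x hx =>
      (smoothTransition.zero_of_nonpos hx).symm
  have htop : Tendsto smoothTransition atTop (𝓝 1) :=
    tendsto_const_nhds.congr' <| (eventually_ge_atTop 1).mono fun x hx =>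
      (smoothTransition.one_of_one_le hx).symm
  rw [integral_of_hasDerivAt_of_tendsto hasDerivAt_smoothTransition
    (continuous_deriv_smoothTransition.integrable_of_hasCompactSupport
      hasCompactSupport_deriv_smoothTransition) hbot htop, sub_zero]

/-- A convex `C²` approximation of the positive part: it vanishes on `(-∞, 0]` and has slope `1` on
`[1, ∞)`. -/
noncomputable def ramp (x : ℝ) : ℝ := ∫ y in (0 : ℝ)..x, smoothTransition y

lemma hasDerivAt_ramp (x : ℝ) : HasDerivAt ramp (smoothTransition x) x :=
  smoothTransition.continuous.integral_hasStrictDerivAt 0 x |>.hasDerivAt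

lemma contDiff_ramp : ContDiff ℝ 2 ramp := by
  have hderiv : deriv ramp = smoothTransition := funext fun x => (hasDerivAt_ramp x).deriv
  rw [show (2 : WithTop ℕ∞) = 1 + 1 from one_add_one_eq_two.symm, contDiff_succ_iff_deriv, hderiv]
  exact ⟨fun x => (hasDerivAt_ramp x).differentiableAt, by simp, smoothTransition.contDiff⟩

lemma ramp_of_nonpos {x : ℝ} (hx : x ≤ 0) : ramp x = 0 := by
  unfold ramp
  rw [intervalIntegral.integral_congr (g := fun _ => (0 : ℝ)), intervalIntegral.integral_zero]
  intro y hy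
  rw [uIcc_of_ge hx] at hy
  exact smoothTransition.zero_of_nonpos hy.2

lemma monotone_ramp : Monotone ramp :=
  monotone_of_hasDerivAt_nonneg hasDerivAt_ramp smoothTransition.nonneg

lemma ramp_nonneg (x : ℝ) : 0 ≤ ramp x := by
  rcases le_total x 0 with h | h
  · exact (ramp_of_nonpos h).ge
  · exact (ramp_of_nonpos le_rfl).ge.trans (monotone_ramp h)

lemma ramp_sub_le {x y : ℝ} (h : x ≤ y) : ramp y - ramp x ≤ y - x := by
  have hmono : Monotone fun x => x - ramp x :=
    monotone_of_hasDerivAt_nonneg (fun x => (hasDerivAt_id' x).sub (hasDerivAt_ramp x))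
      fun x => sub_nonneg.2 (smoothTransition.le_one x)
  linarith [show x - ramp x ≤ y - ramp y from hmono h]

lemma ramp_of_one_le {x : ℝ} (hx : 1 ≤ x) : ramp x = ramp 1 + (x - 1) := by
  have hslope : ∫ y in (1 : ℝ)..x, smoothTransition y = x - 1 := by
    rw [intervalIntegral.integral_congr (g := fun _ => (1 : ℝ))]
    · simp
    · intro y hy
      rw [uIcc_of_le hx] at hy
      exact smoothTransition.one_of_one_le hy.1
  rw [ramp, ramp, ← hslope, intervalIntegral.integral_add_adjacent_intervals] <;>
  exact smoothTransition.continuous.intervalIntegrable _ _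

lemma ramp_le_max (x : ℝ) : ramp x ≤ max x 0 := by
  rcases le_total x 0 with h | h
  · exact (ramp_of_nonpos h).trans_le (le_max_right _ _)
  · refine le_max_of_le_left ?_
    simpa only [ramp_of_nonpos le_rfl, sub_zero] using ramp_sub_le h

/-! ### The Laplacian -/

section Laplacian

variable {E F : Type*} [NormedAddCommGroup E] [InnerProductSpace ℝ E]
  [NormedAddCommGroup F] [NormedSpace ℝ F]

lemma affineIsometryEquiv_apply (g : E ≃ᵃⁱ[ℝ] E) (x : E) :
    g x = g.linearIsometryEquiv x + g 0 := by
  simpa using g.map_vadd 0 x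

lemma fderiv_comp_affineIsometryEquiv (g : E ≃ᵃⁱ[ℝ] E) (f : E → F) (x : E) :
    fderiv ℝ (fun y => f (g y)) x =
      (fderiv ℝ f (g x)).comp (g.linearIsometryEquiv : E →L[ℝ] E) := by
  have hcomp : (fun y => f (g y)) =
      (fun z => f (z + g 0)) ∘ g.linearIsometryEquiv.toContinuousLinearEquiv :=
    funext fun y => congrArg f (affineIsometryEquiv_apply g y)
  rw [hcomp, ContinuousLinearEquiv.comp_right_fderiv, fderiv_comp_add_right,
    affineIsometryEquiv_apply g x]
  rfl

lemma fderiv_fderiv_comp_affineIsometryEquiv (g : E ≃ᵃⁱ[ℝ] E) (f : E → F) (x : E) :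
    fderiv ℝ (fderiv ℝ fun y => f (g y)) x = (fderiv ℝ (fderiv ℝ f) (g x)).bilinearComp
      (g.linearIsometryEquiv : E →L[ℝ] E) (g.linearIsometryEquiv : E →L[ℝ] E) := by
  set A := g.linearIsometryEquiv.toContinuousLinearEquiv
  have hcomp : (fderiv ℝ fun y => f (g y)) =
      (A.symm.arrowCongr (.refl ℝ F)) ∘ fun y => fderiv ℝ f (g y) :=
    funext fun y => by rw [fderiv_comp_affineIsometryEquiv]; rfl
  rw [hcomp, ContinuousLinearEquiv.comp_fderiv, fderiv_comp_affineIsometryEquiv]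
  rfl

variable [FiniteDimensional ℝ E]

lemma laplacian_eq_sum_fderiv {ι : Type*} [Fintype ι] (v : OrthonormalBasis ι ℝ E) (f : E → F)
    (x : E) : Δ f x = ∑ i, fderiv ℝ (fderiv ℝ f) x (v i) (v i) := by
  simp [laplacian_eq_iteratedFDeriv_orthonormalBasis f v, iteratedFDeriv_two_apply]

lemma laplacian_comp_affineIsometryEquiv (g : E ≃ᵃⁱ[ℝ] E) (f : E → F) (x : E) :
    Δ (fun y => f (g y)) x = Δ f (g x) := by
  let v := stdOrthonormalBasis ℝ E
  rw [laplacian_eq_sum_fderiv v, laplacian_eq_sum_fderiv (v.map g.linearIsometryEquiv)]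
  simp [fderiv_fderiv_comp_affineIsometryEquiv]

lemma sum_sq_apply_orthonormalBasis {ι : Type*} [Fintype ι] (v : OrthonormalBasis ι ℝ E)
    (L : E →L[ℝ] ℝ) : ∑ i, L (v i) ^ 2 = ‖L‖ ^ 2 := by
  rw [← (toDual ℝ E).symm.norm_map, ← v.sum_sq_inner_left]
  simp only [toDual_symm_apply]

lemma laplacian_comp {f : E → ℝ} {j j' : ℝ → ℝ} {j'' : ℝ} {x : E} (hf : ContDiffAt ℝ 2 f x)
    (hj : ∀ᶠ y in 𝓝 (f x), HasDerivAt j (j' y) y) (hj' : HasDerivAt j' j'' (f x)) :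
    Δ (fun y => j (f y)) x = j' (f x) * Δ f x + j'' * ‖fderiv ℝ f x‖ ^ 2 := by
  have hdiff : ∀ᶠ y in 𝓝 x, DifferentiableAt ℝ f y :=
    (hf.eventually (by simp)).mono fun y hy => hy.differentiableAt (by simp)
  have hfirst : fderiv ℝ (fun y => j (f y)) =ᶠ[𝓝 x] fun y => j' (f y) • fderiv ℝ f y := by
    filter_upwards [hdiff, hf.continuousAt.eventually hj] with y hy hjy
    exact (hjy.comp_hasFDerivAt y hy.hasFDerivAt).fderiv
  have hsecond : HasFDerivAt (fun y => j' (f y) • fderiv ℝ f y) _ x :=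
    (hj'.comp_hasFDerivAt x hdiff.self_of_nhds.hasFDerivAt).smul
      ((hf.fderiv_right (m := 1) (by norm_num)).differentiableAt (by simp)).hasFDerivAt
  let v := stdOrthonormalBasis ℝ E
  rw [laplacian_eq_sum_fderiv v, laplacian_eq_sum_fderiv v, hfirst.fderiv_eq,
    ← sum_sq_apply_orthonormalBasis v, Finset.mul_sum, Finset.mul_sum, ← Finset.sum_add_distrib]
  refine Finset.sum_congr rfl fun i _ => ?_
  have := congrArg (fun L => L (v i) (v i)) hsecond.fderiv
  simpa [sq, mul_assoc] using this

lemma laplacian_norm_sq (x : E) : Δ (fun y : E => ‖y‖ ^ 2) x = 2 * Module.finrank ℝ E := by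
  have hderiv : fderiv ℝ (fderiv ℝ fun y : E => ‖y‖ ^ 2) x = (2 : ℕ) • innerSL ℝ := by
    rw [fderiv_norm_sq]
    exact ((2 : ℕ) • innerSL ℝ (E := E)).fderiv
  simp [laplacian_eq_sum_fderiv (stdOrthonormalBasis ℝ E), hderiv, mul_comm,
    innerSL_apply_apply ℝ]

lemma continuous_laplacian {f : E → F} (hf : ContDiff ℝ 2 f) : Continuous (Δ f) := by
  have hderiv : Continuous (fderiv ℝ (fderiv ℝ f)) :=
    (hf.fderiv_right (m := 1) (by norm_num)).continuous_fderiv (by simp)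
  rw [funext (laplacian_eq_sum_fderiv (stdOrthonormalBasis ℝ E) f)]
  fun_prop

lemma laplacian_of_notMem_tsupport {f : E → F} {x : E} (hx : x ∉ tsupport f) : Δ f x = 0 := by
  have hf : f =ᶠ[𝓝 x] fun _ => 0 := notMem_tsupport_iff_eventuallyEq.1 hx
  rw [(laplacian_congr_nhds hf).self_of_nhds, laplacian_const, Pi.zero_apply]

lemma hasCompactSupport_laplacian {f : E → F} (hf : HasCompactSupport f) :
    HasCompactSupport (Δ f) :=
  hf.mono' fun _ hx => not_imp_comm.1 laplacian_of_notMem_tsupport hx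

variable [MeasurableSpace E] [BorelSpace E]

lemma integral_mul_fderiv_eq_neg_of_hasCompactSupport {f φ : E → ℝ} (hf : ContDiff ℝ 1 f)
    (hφ : ContDiff ℝ 1 φ) (hφc : HasCompactSupport φ) (w : E) :
    ∫ x, f x * fderiv ℝ φ x w = -∫ x, fderiv ℝ f x w * φ x := by
  have hf' := hf.continuous_fderiv one_ne_zero
  have hφ' := hφ.continuous_fderiv one_ne_zero
  have hφc' : HasCompactSupport fun x => fderiv ℝ φ x w :=
    (hφc.fderiv ℝ).comp_left (g := fun L : E →L[ℝ] ℝ => L w) rfl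
  refine integral_mul_fderiv_eq_neg_fderiv_mul_of_integrable ?_ ?_ ?_
    (fun x _ => hf.differentiable one_ne_zero x) (fun x _ => hφ.differentiable one_ne_zero x)
  · exact (Continuous.mul (by fun_prop) hφ.continuous).integrable_of_hasCompactSupport hφc.mul_left
  · exact (hf.continuous.mul (by fun_prop)).integrable_of_hasCompactSupport hφc'.mul_left
  · exact (hf.continuous.mul hφ.continuous).integrable_of_hasCompactSupport hφc.mul_left

lemma integral_mul_fderiv_fderiv_comm {f φ : E → ℝ} (hf : ContDiff ℝ 2 f) (hφ : ContDiff ℝ 2 φ)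
    (hφc : HasCompactSupport φ) (w : E) :
    ∫ x, f x * fderiv ℝ (fderiv ℝ φ) x w w = ∫ x, fderiv ℝ (fderiv ℝ f) x w w * φ x := by
  have hderiv : ∀ {g : E → ℝ}, ContDiff ℝ 2 g → ContDiff ℝ 1 (fderiv ℝ g) := fun hg =>
    hg.fderiv_right (by norm_num)
  have happly : ∀ {g : E → ℝ}, ContDiff ℝ 2 g → ContDiff ℝ 1 fun x => fderiv ℝ g x w :=
    fun hg => (hderiv hg).clm_apply contDiff_const
  have hfderiv : ∀ {g : E → ℝ}, ContDiff ℝ 2 g → ∀ x,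
      fderiv ℝ (fderiv ℝ g) x w w = fderiv ℝ (fun y => fderiv ℝ g y w) x w := fun hg x => by
    rw [fderiv_clm_apply ((hderiv hg).differentiable one_ne_zero x) (by fun_prop)]
    simp
  have hφc' : HasCompactSupport fun x => fderiv ℝ φ x w :=
    (hφc.fderiv ℝ).comp_left (g := fun L : E →L[ℝ] ℝ => L w) rfl
  simp only [hfderiv hf, hfderiv hφ]
  rw [integral_mul_fderiv_eq_neg_of_hasCompactSupport (hf.of_le one_le_two) (happly hφ) hφc',
    integral_mul_fderiv_eq_neg_of_hasCompactSupport (happly hf) (hφ.of_le one_le_two) hφc, neg_neg]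

lemma integral_mul_laplacian_comm {f φ : E → ℝ} (hf : ContDiff ℝ 2 f) (hφ : ContDiff ℝ 2 φ)
    (hφc : HasCompactSupport φ) : ∫ x, f x * Δ φ x = ∫ x, Δ f x * φ x := by
  have hf' : Continuous (fderiv ℝ (fderiv ℝ f)) :=
    (hf.fderiv_right (m := 1) (by norm_num)).continuous_fderiv (by simp)
  have hφ' : Continuous (fderiv ℝ (fderiv ℝ φ)) :=
    (hφ.fderiv_right (m := 1) (by norm_num)).continuous_fderiv (by simp)
  have hφc' : ∀ w, HasCompactSupport fun x => fderiv ℝ (fderiv ℝ φ) x w w := fun w =>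
    ((hφc.fderiv ℝ).fderiv ℝ).comp_left (g := fun L : E →L[ℝ] E →L[ℝ] ℝ => L w w) rfl
  simp only [laplacian_eq_sum_fderiv (stdOrthonormalBasis ℝ E), Finset.mul_sum, Finset.sum_mul]
  rw [integral_finsetSum, integral_finsetSum]
  · exact Finset.sum_congr rfl fun i _ => integral_mul_fderiv_fderiv_comm hf hφ hφc _
  · exact fun i _ => (Continuous.mul (by fun_prop)
      hφ.continuous).integrable_of_hasCompactSupport hφc.mul_left
  · exact fun i _ => (hf.continuous.mul (by fun_prop)).integrable_of_hasCompactSupport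
      (hφc' _).mul_left

end Laplacian

/-! ### Logarithmic cutoff functions -/

section Cutoff

/-- The profile, as a function of `log ‖x‖²`, of the logarithmic cutoff of parameter `N`: it
decreases from `1` on `(-∞, 0]` to `0` on `[N + 1, ∞)`, essentially with slope `-1 / N`. -/
noncomputable def cutoffProfile (N l : ℝ) : ℝ := 1 - (ramp l - ramp (l - N)) / N

lemma contDiff_cutoffProfile (N : ℝ) : ContDiff ℝ 2 (cutoffProfile N) :=
  contDiff_const.sub
    ((contDiff_ramp.sub (contDiff_ramp.comp (contDiff_id.sub contDiff_const))).div_const N)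

lemma hasDerivAt_cutoffProfile (N l : ℝ) :
    HasDerivAt (cutoffProfile N) ((smoothTransition (l - N) - smoothTransition l) / N) l := by
  refine (((hasDerivAt_ramp l).sub
    ((hasDerivAt_ramp (l - N)).comp_sub_const l N)).div_const N).const_sub 1 |>.congr_deriv ?_
  ring

lemma hasDerivAt_deriv_cutoffProfile (N l : ℝ) :
    HasDerivAt (fun l => (smoothTransition (l - N) - smoothTransition l) / N)
      ((deriv smoothTransition (l - N) - deriv smoothTransition l) / N) l :=
  (((hasDerivAt_smoothTransition (l - N)).comp_sub_const l N).sub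
    (hasDerivAt_smoothTransition l)).div_const N

lemma cutoffProfile_of_nonpos {N l : ℝ} (hN : 0 ≤ N) (hl : l ≤ 0) : cutoffProfile N l = 1 := by
  rw [cutoffProfile, ramp_of_nonpos hl, ramp_of_nonpos (by linarith), sub_self, zero_div, sub_zero]

lemma cutoffProfile_of_le {N l : ℝ} (hN : 0 < N) (hl : N + 1 ≤ l) : cutoffProfile N l = 0 := by
  rw [cutoffProfile, ramp_of_one_le (by linarith), ramp_of_one_le (x := l - N) (by linarith)]
  field_simp
  ring

lemma cutoffProfile_nonneg {N : ℝ} (hN : 0 < N) (l : ℝ) : 0 ≤ cutoffProfile N l := by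
  have hle : ramp l - ramp (l - N) ≤ l - (l - N) := ramp_sub_le (by linarith)
  exact sub_nonneg.2 ((div_le_one hN).2 (by linarith))

lemma cutoffProfile_le_one {N : ℝ} (hN : 0 ≤ N) (l : ℝ) : cutoffProfile N l ≤ 1 :=
  sub_le_self _ (div_nonneg (sub_nonneg.2 (monotone_ramp (by linarith))) hN)

lemma tendsto_cutoffProfile (l : ℝ) : Tendsto (fun N => cutoffProfile N l) atTop (𝓝 1) := by
  have hlim : Tendsto (fun N : ℝ => 1 - ramp l / N) atTop (𝓝 (1 - 0)) :=
    tendsto_const_nhds.sub (tendsto_const_nhds.div_atTop tendsto_id)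
  rw [sub_zero] at hlim
  refine hlim.congr' ?_
  filter_upwards [eventually_ge_atTop l] with N hN
  rw [cutoffProfile, ramp_of_nonpos (x := l - N) (by linarith), sub_zero]

/-- The logarithmic cutoff function of parameter `N`, equal to `1` on the unit ball and supported in
the ball of radius `exp ((N + 1) / 2)`. Its value `1` at the origin comes from `Real.log 0 = 0`. -/
noncomputable def cutoff (N : ℝ) (x : Plane) : ℝ := cutoffProfile N (Real.log (‖x‖ ^ 2))

/-- The weight of unit logarithmic width carried by the annulus `a ≤ log ‖x‖² ≤ a + 1`; the
Laplacian of a logarithmic cutoff is a difference of two such weights. -/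
noncomputable def annulusWeight (a : ℝ) (x : Plane) : ℝ :=
  4 * deriv smoothTransition (Real.log (‖x‖ ^ 2) - a) / ‖x‖ ^ 2

lemma log_sq_nonpos {r : ℝ} (h0 : 0 ≤ r) (h1 : r ≤ 1) : Real.log (r ^ 2) ≤ 0 :=
  Real.log_nonpos (by positivity) (pow_le_one₀ h0 h1)

lemma le_log_sq {a r : ℝ} (h : Real.exp (a / 2) ≤ r) : a ≤ Real.log (r ^ 2) := by
  rw [Real.le_log_iff_exp_le (pow_pos ((Real.exp_pos _).trans_le h) 2),
    show a = a / 2 + a / 2 by ring, Real.exp_add, ← sq]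
  gcongr

lemma eventually_norm_le_one {E : Type*} [SeminormedAddGroup E] : ∀ᶠ x : E in 𝓝 0, ‖x‖ ≤ 1 := by
  filter_upwards [Metric.closedBall_mem_nhds (0 : E) one_pos] with x hx
  rwa [← mem_closedBall_zero_iff]

lemma contDiffAt_log_norm_sq {E : Type*} [NormedAddCommGroup E] [InnerProductSpace ℝ E] {x : E}
    (hx : x ≠ 0) : ContDiffAt ℝ 2 (fun y : E => Real.log (‖y‖ ^ 2)) x :=
  (contDiff_norm_sq ℝ).contDiffAt.log (pow_ne_zero 2 (norm_ne_zero_iff.2 hx))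

lemma cutoff_of_norm_le_one {N : ℝ} {x : Plane} (hN : 0 ≤ N) (hx : ‖x‖ ≤ 1) : cutoff N x = 1 :=
  cutoffProfile_of_nonpos hN (log_sq_nonpos (norm_nonneg x) hx)

lemma contDiff_cutoff {N : ℝ} (hN : 0 ≤ N) : ContDiff ℝ 2 (cutoff N) := by
  refine contDiff_iff_contDiffAt.2 fun x => ?_
  rcases eq_or_ne x 0 with rfl | hx
  · refine (contDiffAt_const (c := (1 : ℝ))).congr_of_eventuallyEq ?_
    exact eventually_norm_le_one.mono fun y hy => cutoff_of_norm_le_one hN hy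
  · exact (contDiff_cutoffProfile N).contDiffAt.comp x (contDiffAt_log_norm_sq hx)

lemma cutoff_nonneg {N : ℝ} (hN : 0 < N) (x : Plane) : 0 ≤ cutoff N x := cutoffProfile_nonneg hN _

lemma cutoff_le_one {N : ℝ} (hN : 0 ≤ N) (x : Plane) : cutoff N x ≤ 1 := cutoffProfile_le_one hN _

lemma tendsto_cutoff (x : Plane) : Tendsto (fun N => cutoff N x) atTop (𝓝 1) :=
  tendsto_cutoffProfile _

lemma hasCompactSupport_of_log_norm_sq {E F : Type*} [NormedAddCommGroup E] [ProperSpace E]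
    [Zero F] {f : E → F} {a : ℝ} (hf : ∀ x, a ≤ Real.log (‖x‖ ^ 2) → f x = 0) :
    HasCompactSupport f :=
  .intro (isCompact_closedBall 0 (Real.exp (a / 2))) fun x hx =>
    hf x (le_log_sq (not_le.1 fun h => hx (mem_closedBall_zero_iff.2 h)).le)

lemma hasCompactSupport_cutoff {N : ℝ} (hN : 0 < N) : HasCompactSupport (cutoff N) :=
  hasCompactSupport_of_log_norm_sq fun _ hx => cutoffProfile_of_le hN hx

lemma annulusWeight_nonneg (a : ℝ) (x : Plane) : 0 ≤ annulusWeight a x :=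
  div_nonneg (mul_nonneg (by norm_num) (deriv_smoothTransition_nonneg _)) (by positivity)

lemma annulusWeight_of_norm_le_one {a : ℝ} {x : Plane} (ha : 0 ≤ a) (hx : ‖x‖ ≤ 1) :
    annulusWeight a x = 0 := by
  have hlog := log_sq_nonpos (norm_nonneg x) hx
  rw [annulusWeight, deriv_smoothTransition_of_nonpos (by linarith), mul_zero, zero_div]

lemma hasCompactSupport_annulusWeight (a : ℝ) : HasCompactSupport (annulusWeight a) :=
  hasCompactSupport_of_log_norm_sq (a := a + 1) fun x hx => by
    rw [annulusWeight, deriv_smoothTransition_of_one_le (by linarith), mul_zero, zero_div]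

lemma continuous_annulusWeight {a : ℝ} (ha : 0 ≤ a) : Continuous (annulusWeight a) := by
  refine continuous_iff_continuousAt.2 fun x => ?_
  rcases eq_or_ne x 0 with rfl | hx
  · refine (continuousAt_const (y := (0 : ℝ))).congr ?_
    exact eventually_norm_le_one.mono fun y hy => (annulusWeight_of_norm_le_one ha hy).symm
  · refine ContinuousAt.div ?_ (by fun_prop) (pow_ne_zero 2 (norm_ne_zero_iff.2 hx))
    exact continuousAt_const.mul (continuous_deriv_smoothTransition.continuousAt.comp
      ((contDiffAt_log_norm_sq hx).continuousAt.sub continuousAt_const))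

lemma exists_annulusWeight_mul_norm_sq_le : ∃ C, ∀ a x, annulusWeight a x * ‖x‖ ^ 2 ≤ C := by
  obtain ⟨B, hB⟩ := exists_deriv_smoothTransition_le
  refine ⟨4 * B, fun a x => ?_⟩
  calc annulusWeight a x * ‖x‖ ^ 2
      ≤ 4 * deriv smoothTransition (Real.log (‖x‖ ^ 2) - a) :=
        mul_le_of_le_div₀ (mul_nonneg (by norm_num) (deriv_smoothTransition_nonneg _))
          (by positivity) le_rfl
    _ ≤ 4 * B := by linarith [hB (Real.log (‖x‖ ^ 2) - a)]

lemma laplacian_comp_log_norm_sq {x : Plane} (hx : x ≠ 0) {k k' : ℝ → ℝ} {k'' : ℝ}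
    (hk : ∀ l, HasDerivAt k (k' l) l) (hk' : HasDerivAt k' k'' (Real.log (‖x‖ ^ 2))) :
    Δ (fun y : Plane => k (Real.log (‖y‖ ^ 2))) x = 4 * k'' / ‖x‖ ^ 2 := by
  have hs : ‖x‖ ^ 2 ≠ 0 := pow_ne_zero 2 (norm_ne_zero_iff.2 hx)
  have hfirst : ∀ᶠ s in 𝓝 (‖x‖ ^ 2), HasDerivAt (fun s => k (Real.log s))
      (k' (Real.log s) * s⁻¹) s := by
    filter_upwards [isOpen_ne.mem_nhds hs] with s hs
    exact (hk _).comp s (Real.hasDerivAt_log hs)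
  have hsecond := (hk'.comp (‖x‖ ^ 2) (Real.hasDerivAt_log hs)).mul (hasDerivAt_inv hs)
  rw [laplacian_comp (contDiff_norm_sq ℝ).contDiffAt hfirst hsecond, laplacian_norm_sq,
    fderiv_norm_sq_apply, finrank_euclideanSpace_fin, ← Nat.cast_smul_eq_nsmul ℝ,
    norm_smul, innerSL_apply_norm, mul_pow]
  simp only [Function.comp_def, Nat.cast_ofNat, Real.norm_ofNat]
  field_simp
  ring

lemma laplacian_cutoff {N : ℝ} (hN : 0 ≤ N) (x : Plane) :
    Δ (cutoff N) x = (annulusWeight N x - annulusWeight 0 x) / N := by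
  rcases eq_or_ne x 0 with rfl | hx
  · have hone : cutoff N =ᶠ[𝓝 0] fun _ => 1 :=
      eventually_norm_le_one.mono fun y hy => cutoff_of_norm_le_one hN hy
    rw [(laplacian_congr_nhds hone).self_of_nhds, laplacian_const]
    simp [annulusWeight]
  · refine (laplacian_comp_log_norm_sq hx (hasDerivAt_cutoffProfile N)
      (hasDerivAt_deriv_cutoffProfile N _)).trans ?_
    rw [annulusWeight, annulusWeight, sub_zero]
    ring

lemma integral_comp_log_norm_sq_div (k : ℝ → ℝ) :
    ∫ x : Plane, k (Real.log (‖x‖ ^ 2)) / ‖x‖ ^ 2 = Real.pi * ∫ l, k l := by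
  have hvol : (volume : Measure Plane).real (Metric.ball 0 1) = Real.pi := by
    simp [Measure.real, EuclideanSpace.volume_ball_fin_two, Real.pi_pos.le]
  have hexp : (fun l : ℝ => Real.exp (l / 2)) '' univ = Ioi 0 := by
    ext r
    simp only [image_univ, mem_range, mem_Ioi]
    refine ⟨fun ⟨l, hl⟩ => hl ▸ Real.exp_pos _, fun hr => ⟨2 * Real.log r, ?_⟩⟩
    rw [mul_div_cancel_left₀ _ two_ne_zero, Real.exp_log hr]
  have hderiv : ∀ l, HasDerivAt (fun l : ℝ => Real.exp (l / 2)) (Real.exp (l / 2) * (1 / 2)) l :=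
    fun l => ((hasDerivAt_id' l).div_const 2).exp
  have hpolar : ∫ r in Ioi (0 : ℝ), r * (k (Real.log (r ^ 2)) / r ^ 2) = ∫ l, k l / 2 := by
    rw [← hexp, integral_image_eq_integral_abs_deriv_smul MeasurableSet.univ
      (fun l _ => (hderiv l).hasDerivWithinAt) (fun l _ m _ h => by simpa using h),
      setIntegral_univ]
    refine integral_congr_ae (.of_forall fun l => ?_)
    have hsq : Real.exp (l / 2) ^ 2 = Real.exp l := by
      rw [sq, ← Real.exp_add, add_halves]
    simp only [hsq, Real.log_exp, abs_of_pos (mul_pos (Real.exp_pos _) one_half_pos),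
      smul_eq_mul]
    rw [← hsq]
    field_simp
  rw [integral_fun_norm_addHaar volume fun r => k (Real.log (r ^ 2)) / r ^ 2, hvol]
  simp only [finrank_euclideanSpace_fin, Nat.add_one_sub_one, pow_one, smul_eq_mul, hpolar,
    integral_div]
  ring

lemma integral_log_mul_laplacian_cutoff {N : ℝ} (hN : 0 < N) :
    ∫ x, Real.log (‖x‖ ^ 2) * Δ (cutoff N) x = 4 * Real.pi := by
  have hint : ∀ {f : ℝ → ℝ}, Continuous f → Integrable fun l => f l * deriv smoothTransition l :=
    fun hf => (hf.mul continuous_deriv_smoothTransition).integrable_of_hasCompactSupport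
      hasCompactSupport_deriv_smoothTransition.mul_left
  have hshift : (fun l => l * deriv smoothTransition (l - N)) =
      fun l => (fun m => (m + N) * deriv smoothTransition m) (l - N) :=
    funext fun l => by simp only [sub_add_cancel]
  calc ∫ x, Real.log (‖x‖ ^ 2) * Δ (cutoff N) x
      = Real.pi * ∫ l, 4 / N *
          (l * deriv smoothTransition (l - N) - l * deriv smoothTransition l) := by
        rw [← integral_comp_log_norm_sq_div]
        refine integral_congr_ae (.of_forall fun x => ?_)
        simp only [laplacian_cutoff hN.le, annulusWeight, sub_zero]
        ring
    _ = Real.pi * (4 / N *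
          ∫ l, ((l + N) * deriv smoothTransition l - l * deriv smoothTransition l)) := by
        rw [integral_const_mul, integral_sub, integral_sub, hshift,
          integral_sub_right_eq_self (fun m => (m + N) * deriv smoothTransition m)]
        exacts [hint (by fun_prop), hint continuous_id,
          hshift ▸ (hint (f := fun m => m + N) (by fun_prop)).comp_sub_right N, hint continuous_id]
    _ = 4 * Real.pi := by
        simp only [add_mul, add_sub_cancel_left, integral_const_mul,
          integral_deriv_smoothTransition]
        field_simp

end Cutoff

/-! ### Kato's inequality -/

/-- The indicator function of the positive half line. -/
noncomputable def heaviside (a : ℝ) : ℝ := if 0 < a then 1 else 0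

lemma measurable_heaviside : Measurable heaviside :=
  Measurable.ite measurableSet_Ioi measurable_const measurable_const

lemma abs_heaviside_le_one (a : ℝ) : |heaviside a| ≤ 1 := by
  unfold heaviside; split_ifs <;> simp

/-- A `C²` approximation from below of the positive part of `a`. It vanishes for all `a ≤ ε`, so
that composing it with a continuous function gives `0` in a neighbourhood of the zeros. -/
noncomputable def smoothPosPart (ε a : ℝ) : ℝ := ε * ramp (a / ε - 1)

lemma contDiff_smoothPosPart (ε : ℝ) : ContDiff ℝ 2 (smoothPosPart ε) :=
  contDiff_const.mul (contDiff_ramp.comp ((contDiff_id.div_const ε).sub contDiff_const))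

lemma smoothPosPart_of_le {ε a : ℝ} (hε : 0 < ε) (ha : a ≤ ε) : smoothPosPart ε a = 0 := by
  rw [smoothPosPart, ramp_of_nonpos (sub_nonpos.2 ((div_le_one hε).2 ha)), mul_zero]

lemma smoothPosPart_nonneg {ε : ℝ} (hε : 0 < ε) (a : ℝ) : 0 ≤ smoothPosPart ε a :=
  mul_nonneg hε.le (ramp_nonneg _)

lemma smoothPosPart_le_max {ε : ℝ} (hε : 0 < ε) (a : ℝ) : smoothPosPart ε a ≤ max a 0 :=
  calc ε * ramp (a / ε - 1) ≤ ε * max (a / ε) 0 :=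
        mul_le_mul_of_nonneg_left
          ((ramp_le_max _).trans (max_le_max (sub_le_self _ zero_le_one) le_rfl)) hε.le
    _ = max a 0 := by rw [mul_max_of_nonneg _ _ hε.le, mul_div_cancel₀ _ hε.ne', mul_zero]

lemma tendsto_smoothPosPart (a : ℝ) :
    Tendsto (fun ε : ℝ => smoothPosPart ε a) (𝓝[>] 0) (𝓝 (max a 0)) := by
  rcases lt_or_ge 0 a with ha | ha
  · have hlim : Tendsto (fun ε : ℝ => a + ε * (ramp 1 - 2)) (𝓝[>] 0) (𝓝 a) := by
      refine (Continuous.tendsto' ?_ 0 a ?_).mono_left nhdsWithin_le_nhds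
      · fun_prop
      · simp
    rw [max_eq_left ha.le]
    refine hlim.congr' ?_
    filter_upwards [Ioo_mem_nhdsGT (half_pos ha)] with ε hε
    have h2 : 2 ≤ a / ε := (le_div_iff₀ hε.1).2 (by linarith [hε.2])
    have hε0 := hε.1.ne'
    rw [smoothPosPart, ramp_of_one_le (x := a / ε - 1) (by linarith)]
    field_simp
    ring
  · rw [max_eq_right ha]
    refine tendsto_const_nhds.congr' ?_
    filter_upwards [self_mem_nhdsWithin] with ε hε
    exact (smoothPosPart_of_le hε (ha.trans (le_of_lt hε))).symm

lemma hasDerivAt_smoothPosPart {ε : ℝ} (hε : ε ≠ 0) (a : ℝ) :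
    HasDerivAt (smoothPosPart ε) (smoothTransition (a / ε - 1)) a :=
  (((hasDerivAt_ramp (a / ε - 1)).comp (h := fun a => a / ε - 1) a
    (((hasDerivAt_id' a).div_const ε).sub_const 1)).const_mul ε).congr_deriv (by field_simp)

lemma hasDerivAt_smoothTransition_div (ε a : ℝ) :
    HasDerivAt (fun a => smoothTransition (a / ε - 1))
      (deriv smoothTransition (a / ε - 1) / ε) a :=
  ((hasDerivAt_smoothTransition (a / ε - 1)).comp (h := fun a => a / ε - 1) a
    (((hasDerivAt_id' a).div_const ε).sub_const 1)).congr_deriv (by ring)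

lemma tendsto_smoothTransition_div (a : ℝ) :
    Tendsto (fun ε : ℝ => smoothTransition (a / ε - 1)) (𝓝[>] 0) (𝓝 (heaviside a)) := by
  refine tendsto_const_nhds.congr' ?_
  rcases lt_or_ge 0 a with ha | ha
  · filter_upwards [Ioo_mem_nhdsGT (half_pos ha)] with ε hε
    have h2 : 2 ≤ a / ε := (le_div_iff₀ hε.1).2 (by linarith [hε.2])
    rw [smoothTransition.one_of_one_le (by linarith), heaviside, if_pos ha]
  · filter_upwards [self_mem_nhdsWithin] with ε hε
    have h0 : a / ε ≤ 0 := div_nonpos_of_nonpos_of_nonneg ha (le_of_lt hε)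
    rw [smoothTransition.zero_of_nonpos (by linarith), heaviside, if_neg ha.not_gt]

lemma abs_smoothTransition_mul_le (x c : ℝ) : |smoothTransition x * c| ≤ |c| := by
  rw [abs_mul, abs_of_nonneg (smoothTransition.nonneg _)]
  exact mul_le_of_le_one_left (abs_nonneg _) (smoothTransition.le_one _)

lemma integral_heaviside_mul_deriv {w w' : ℝ → ℝ} {a b : ℝ} (hab : a ≤ b)
    (hw : ∀ s ∈ Icc a b, HasDerivAt w (w' s) s) (hw' : ContinuousOn w' (Icc a b)) :
    ∫ s in a..b, heaviside (w s) * w' s = max (w b) 0 - max (w a) 0 := by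
  rw [← uIcc_of_le hab] at hw hw'
  have hwc : ContinuousOn w (uIcc a b) := fun s hs => (hw s hs).continuousAt.continuousWithinAt
  have hcont : ∀ ε : ℝ, ContinuousOn (fun s => smoothTransition (w s / ε - 1) * w' s)
      (uIcc a b) := fun ε => (smoothTransition.continuous.comp_continuousOn
      ((hwc.div_const ε).sub continuousOn_const)).mul hw'
  have hlim : Tendsto (fun ε : ℝ => ∫ s in a..b, smoothTransition (w s / ε - 1) * w' s) (𝓝[>] 0)
      (𝓝 (∫ s in a..b, heaviside (w s) * w' s)) := by
    refine intervalIntegral.tendsto_integral_filter_of_dominated_convergence (fun s => |w' s|)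
      (.of_forall fun ε => ?_) (.of_forall fun ε => .of_forall fun s _ => ?_)
      hw'.abs.intervalIntegrable (.of_forall fun s _ => ?_)
    · exact ((hcont ε).mono uIoc_subset_uIcc).aestronglyMeasurable measurableSet_uIoc
    · exact abs_smoothTransition_mul_le _ _
    · exact (tendsto_smoothTransition_div _).mul_const _
  refine tendsto_nhds_unique hlim
    (((tendsto_smoothPosPart (w b)).sub (tendsto_smoothPosPart (w a))).congr' ?_)
  filter_upwards [self_mem_nhdsWithin] with ε hε
  exact (intervalIntegral.integral_eq_sub_of_hasDerivAt
    (fun s hs => (hasDerivAt_smoothPosPart (ne_of_gt hε) (w s)).comp s (hw s hs))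
    (hcont ε).intervalIntegrable).symm

section Kato

variable {E : Type*} [NormedAddCommGroup E] {H : Set E} {h φ : E → ℝ} {ε : ℝ}

lemma indicator_smoothPosPart_eventuallyEq_zero (hH : IsOpen H) (hh : Continuous h)
    (hfr : ∀ x ∈ frontier H, h x ≤ 0) (hε : 0 < ε) {x : E} (hx : x ∉ H) :
    H.indicator (fun y => smoothPosPart ε (h y)) =ᶠ[𝓝 x] fun _ => 0 := by
  by_cases hxc : x ∈ closure H
  · have hlt : h x < ε := (hfr x (hH.frontier_eq ▸ ⟨hxc, hx⟩)).trans_lt hε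
    filter_upwards [hh.continuousAt.eventually (gt_mem_nhds hlt)] with y hy
    exact indicator_apply_eq_zero.2 fun _ => smoothPosPart_of_le hε (le_of_lt hy)
  · filter_upwards [isClosed_closure.isOpen_compl.mem_nhds hxc] with y hy
    exact indicator_of_notMem (fun hyH => hy (subset_closure hyH)) _

variable [InnerProductSpace ℝ E]

lemma contDiff_indicator_smoothPosPart (hH : IsOpen H) (hh : ContDiff ℝ 2 h)
    (hfr : ∀ x ∈ frontier H, h x ≤ 0) (hε : 0 < ε) :
    ContDiff ℝ 2 (H.indicator fun y => smoothPosPart ε (h y)) := by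
  refine contDiff_iff_contDiffAt.2 fun x => ?_
  by_cases hx : x ∈ H
  · exact ((contDiff_smoothPosPart ε).comp hh).contDiffAt.congr_of_eventuallyEq
      (eqOn_indicator.eventuallyEq_of_mem (hH.mem_nhds hx))
  · exact contDiffAt_const.congr_of_eventuallyEq
      (indicator_smoothPosPart_eventuallyEq_zero hH hh.continuous hfr hε hx)

variable [FiniteDimensional ℝ E]

lemma indicator_mul_laplacian_le_laplacian_indicator (hH : IsOpen H) (hh : ContDiff ℝ 2 h)
    (hfr : ∀ x ∈ frontier H, h x ≤ 0) (hε : 0 < ε) (x : E) :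
    H.indicator (fun y => smoothTransition (h y / ε - 1) * Δ h y) x ≤
      Δ (H.indicator fun y => smoothPosPart ε (h y)) x := by
  by_cases hx : x ∈ H
  · rw [indicator_of_mem hx, (laplacian_congr_nhds
        (eqOn_indicator.eventuallyEq_of_mem (hH.mem_nhds hx))).self_of_nhds,
      laplacian_comp hh.contDiffAt (.of_forall (hasDerivAt_smoothPosPart hε.ne'))
        (hasDerivAt_smoothTransition_div ε _)]
    exact le_add_of_nonneg_right
      (mul_nonneg (div_nonneg (deriv_smoothTransition_nonneg _) hε.le) (sq_nonneg _))
  · rw [indicator_of_notMem hx, (laplacian_congr_nhds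
      (indicator_smoothPosPart_eventuallyEq_zero hH hh.continuous hfr hε hx)).self_of_nhds,
      laplacian_const, Pi.zero_apply]

variable [MeasurableSpace E] [BorelSpace E]

lemma integral_smoothTransition_mul_laplacian_le (hH : IsOpen H) (hh : ContDiff ℝ 2 h)
    (hfr : ∀ x ∈ frontier H, h x ≤ 0) (hφ : ContDiff ℝ 2 φ) (hφc : HasCompactSupport φ)
    (hφ0 : ∀ x, 0 ≤ φ x) (hε : 0 < ε) :
    ∫ x in H, smoothTransition (h x / ε - 1) * Δ h x * φ x ≤
      ∫ x in H, smoothPosPart ε (h x) * Δ φ x := by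
  have hF := contDiff_indicator_smoothPosPart hH hh hfr hε
  have hslope : Continuous fun x => smoothTransition (h x / ε - 1) * Δ h x :=
    (smoothTransition.continuous.comp ((hh.continuous.div_const ε).sub continuous_const)).mul
      (continuous_laplacian hh)
  calc ∫ x in H, smoothTransition (h x / ε - 1) * Δ h x * φ x
      = ∫ x, H.indicator (fun y => smoothTransition (h y / ε - 1) * Δ h y) x * φ x := by
        rw [← integral_indicator hH.measurableSet]
        simp only [indicator_mul_left _ (fun y => smoothTransition (h y / ε - 1) * Δ h y) φ]
    _ ≤ ∫ x, Δ (H.indicator fun y => smoothPosPart ε (h y)) x * φ x := by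
        refine integral_mono ?_ (((continuous_laplacian hF).mul
          hφ.continuous).integrable_of_hasCompactSupport hφc.mul_left) fun x =>
            mul_le_mul_of_nonneg_right
              (indicator_mul_laplacian_le_laplacian_indicator hH hh hfr hε x) (hφ0 x)
        exact (((hslope.mul hφ.continuous).integrable_of_hasCompactSupport
          hφc.mul_left).indicator hH.measurableSet).congr
            (.of_forall fun x => indicator_mul_left H _ _)
    _ = ∫ x in H, smoothPosPart ε (h x) * Δ φ x := by
        rw [← integral_mul_laplacian_comm hF hφ hφc, ← integral_indicator hH.measurableSet]
        simp only [indicator_mul_left]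

lemma integral_heaviside_mul_laplacian_le (hH : IsOpen H) (hh : ContDiff ℝ 2 h)
    (hfr : ∀ x ∈ frontier H, h x ≤ 0) (hφ : ContDiff ℝ 2 φ) (hφc : HasCompactSupport φ)
    (hφ0 : ∀ x, 0 ≤ φ x) :
    ∫ x in H, heaviside (h x) * Δ h x * φ x ≤ ∫ x in H, max (h x) 0 * Δ φ x := by
  have hhc := hh.continuous
  have hΔh := continuous_laplacian hh
  have hφ' := hφ.continuous
  have hΔφ := continuous_laplacian hφ
  have hΔφc := hasCompactSupport_laplacian hφc
  have hslope := smoothTransition.continuous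
  have hleft : Tendsto (fun ε : ℝ => ∫ x in H, smoothTransition (h x / ε - 1) * Δ h x * φ x)
      (𝓝[>] 0) (𝓝 (∫ x in H, heaviside (h x) * Δ h x * φ x)) := by
    refine tendsto_integral_filter_of_dominated_convergence (fun x => |Δ h x * φ x|)
      (.of_forall fun ε => Continuous.aestronglyMeasurable (by fun_prop))
      (.of_forall fun ε => .of_forall fun x => ?_)
      ((hΔh.mul hφ').integrable_of_hasCompactSupport hφc.mul_left).abs.integrableOn
      (.of_forall fun x => ((tendsto_smoothTransition_div _).mul_const _).mul_const _)
    rw [Real.norm_eq_abs, mul_assoc]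
    exact abs_smoothTransition_mul_le _ _
  have hright : Tendsto (fun ε : ℝ => ∫ x in H, smoothPosPart ε (h x) * Δ φ x) (𝓝[>] 0)
      (𝓝 (∫ x in H, max (h x) 0 * Δ φ x)) := by
    refine tendsto_integral_filter_of_dominated_convergence (fun x => |max (h x) 0 * Δ φ x|)
      (.of_forall fun ε => ?_) ?_
      ((Continuous.mul (by fun_prop) hΔφ).integrable_of_hasCompactSupport
        hΔφc.mul_left).abs.integrableOn
      (.of_forall fun x => (tendsto_smoothPosPart _).mul_const _)
    · exact (((contDiff_smoothPosPart ε).continuous.comp hhc).mul hΔφ).aestronglyMeasurable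
    · filter_upwards [self_mem_nhdsWithin] with ε hε
      refine .of_forall fun x => ?_
      rw [Real.norm_eq_abs, abs_mul, abs_mul, abs_of_nonneg (smoothPosPart_nonneg hε _)]
      exact mul_le_mul_of_nonneg_right ((smoothPosPart_le_max hε _).trans (le_abs_self _))
        (abs_nonneg _)
  refine le_of_tendsto_of_tendsto hleft hright ?_
  filter_upwards [self_mem_nhdsWithin] with ε hε
  exact integral_smoothTransition_mul_laplacian_le hH hh hfr hφ hφc hφ0 hε

end Kato

/-! ### Integration over space-time strips -/

section Strip

variable {X : Type*} [MeasureSpace X] {F : X × ℝ → ℝ} {φ : X → ℝ} {a b : ℝ}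

lemma integrableOn_mul_strip [TopologicalSpace X] [T2Space X] [OpensMeasurableSpace X]
    [IsFiniteMeasureOnCompacts (volume : Measure X)]
    (hF : ContinuousOn F (univ ×ˢ Icc a b)) (hφ : Continuous φ) (hφc : HasCompactSupport φ) :
    IntegrableOn (fun p => F p * φ p.1) (univ ×ˢ Ioc a b) := by
  have hK : IntegrableOn (fun p => F p * φ p.1) (tsupport φ ×ˢ Icc a b) :=
    ((hF.mono (prod_mono_left (subset_univ _))).mul
      (hφ.comp continuous_fst).continuousOn).integrableOn_compact (hφc.isCompact.prod isCompact_Icc)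
  refine (hK.mono_set (prod_mono_right Ioc_subset_Icc_self)).of_forall_sdiff_eq_zero
    (MeasurableSet.univ.prod measurableSet_Ioc) fun p hp => ?_
  rw [image_eq_zero_of_notMem_tsupport fun hx => hp.2 ⟨hx, hp.1.2⟩, mul_zero]

variable [SFinite (volume : Measure X)] {H : Set X}

lemma integral_strip_eq_integral_integral (hF : IntegrableOn F (H ×ˢ Ioc a b)) :
    ∫ p in H ×ˢ Ioc a b, F p = ∫ s in Ioc a b, ∫ x in H, F (x, s) := by
  rw [IntegrableOn, Measure.volume_eq_prod, ← Measure.prod_restrict] at hF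
  rw [Measure.volume_eq_prod, ← Measure.prod_restrict, integral_prod_symm _ hF]

lemma integral_strip_mul_eq_integral_sub_mul {w : X → ℝ → ℝ} (hab : a ≤ b)
    (hF : IntegrableOn (fun p => F p * φ p.1) (H ×ˢ Ioc a b))
    (hw : ∀ x, ∫ s in a..b, F (x, s) = w x b - w x a) :
    ∫ p in H ×ˢ Ioc a b, F p * φ p.1 = ∫ x in H, (w x b - w x a) * φ x := by
  rw [Measure.volume_eq_prod] at hF ⊢
  rw [setIntegral_prod _ hF]
  simp only [integral_mul_const, ← hw, intervalIntegral.integral_of_le hab]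

end Strip

/-! ### The equation on a space-time strip -/

section Solutions

variable {u v : Plane → ℝ → ℝ} {T τ t : ℝ} {φ : Plane → ℝ}

namespace IsClassicalSolution

lemma comp_affineIsometryEquiv (hu : IsClassicalSolution u T) (g : Plane ≃ᵃⁱ[ℝ] Plane) :
    IsClassicalSolution (fun x t => u (g x) t) T := by
  have hg : Continuous fun p : Plane × ℝ => (g p.1, p.2) :=
    (g.continuous.comp continuous_fst).prodMk continuous_snd
  have hmaps : MapsTo (fun p : Plane × ℝ => (g p.1, p.2)) (univ ×ˢ Ioo (0 : ℝ) T)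
      (univ ×ˢ Ioo (0 : ℝ) T) := fun p hp => ⟨mem_univ _, hp.2⟩
  have hpull : ∀ {Y : Type} [TopologicalSpace Y] {F : Plane × ℝ → Y},
      ContinuousOn F (univ ×ˢ Ioo (0 : ℝ) T) →
        ContinuousOn (fun p => F (g p.1, p.2)) (univ ×ˢ Ioo (0 : ℝ) T) :=
    fun hF => hF.comp hg.continuousOn hmaps
  refine ⟨fun x t ht => hu.pos _ t ht, fun t ht => (hu.contDiff_space t ht).comp
      g.toAffineIsometry.toContinuousAffineMap.contDiff,
    fun x t ht => hu.differentiableAt_time _ t ht, hpull hu.continuousOn, ?_, ?_,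
    hpull hu.continuousOn_deriv, fun x t ht => ?_⟩
  · exact ((hpull hu.continuousOn_fderiv).clm_comp continuousOn_const).congr fun p _ =>
      fderiv_comp_affineIsometryEquiv g (fun x => u x p.2) p.1
  · refine ContinuousOn.congr ?_ fun p _ =>
      fderiv_fderiv_comp_affineIsometryEquiv g (fun x => u x p.2) p.1
    refine continuousOn_clm_apply.2 fun a => continuousOn_clm_apply.2 fun b => ?_
    exact ((hpull hu.continuousOn_fderiv_fderiv).clm_apply continuousOn_const).clm_apply
      continuousOn_const
  · exact (hu.equation _ t ht).trans
      (laplacian_comp_affineIsometryEquiv g (fun y => Real.log (u y t)) x).symm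

lemma contDiff_log (hu : IsClassicalSolution u T) {s : ℝ} (hs : s ∈ Ioo 0 T) :
    ContDiff ℝ 2 fun x => Real.log (u x s) :=
  (hu.contDiff_space s hs).log fun x => (hu.pos x s hs).ne'

lemma continuousOn_log_strip (hu : IsClassicalSolution u T) (hτ : 0 < τ) (ht : t < T) :
    ContinuousOn (fun p : Plane × ℝ => Real.log (u p.1 p.2)) (univ ×ˢ Icc τ t) :=
  (hu.continuousOn.log fun p hp => (hu.pos p.1 p.2 hp.2).ne').mono
    (prod_mono_right (Icc_subset_Ioo hτ ht))

lemma continuousOn_deriv_strip (hu : IsClassicalSolution u T) (hτ : 0 < τ) (ht : t < T) :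
    ContinuousOn (fun p : Plane × ℝ => deriv (fun s => u p.1 s) p.2) (univ ×ˢ Icc τ t) :=
  hu.continuousOn_deriv.mono (prod_mono_right (Icc_subset_Ioo hτ ht))

lemma continuousOn_deriv_time (hu : IsClassicalSolution u T) (hτ : 0 < τ) (ht : t < T)
    (x : Plane) : ContinuousOn (deriv fun s => u x s) (Icc τ t) :=
  (hu.continuousOn_deriv_strip hτ ht).comp (f := fun s : ℝ => (x, s)) (by fun_prop)
    fun _ hs => ⟨mem_univ x, hs⟩

lemma hasDerivAt (hu : IsClassicalSolution u T) {s : ℝ} (hs : s ∈ Ioo 0 T) (x : Plane) :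
    HasDerivAt (fun s => u x s) (deriv (fun s => u x s) s) s :=
  (hu.differentiableAt_time x s hs).hasDerivAt

lemma integral_sub_mul_eq_integral_log_mul_laplacian (hu : IsClassicalSolution u T) (hτ : 0 < τ)
    (hτt : τ ≤ t) (ht : t < T) (hφ : ContDiff ℝ 2 φ) (hφc : HasCompactSupport φ) :
    ∫ x, (u x t - u x τ) * φ x =
      ∫ p in univ ×ˢ Ioc τ t, Real.log (u p.1 p.2) * Δ φ p.1 := by
  have hlhs := integrableOn_mul_strip (hu.continuousOn_deriv_strip hτ ht) hφ.continuous hφc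
  have hrhs := integrableOn_mul_strip (hu.continuousOn_log_strip hτ ht) (continuous_laplacian hφ)
    (hasCompactSupport_laplacian hφc)
  have hftc : ∀ x, ∫ s in τ..t, deriv (fun s => u x s) s = u x t - u x τ := fun x => by
    refine intervalIntegral.integral_eq_sub_of_hasDerivAt (fun s hs => ?_)
      ((hu.continuousOn_deriv_time hτ ht x).intervalIntegrable_of_Icc hτt)
    rw [uIcc_of_le hτt] at hs
    exact hu.hasDerivAt (Icc_subset_Ioo hτ ht hs) x
  have hspace := integral_strip_mul_eq_integral_sub_mul hτt hlhs hftc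
  rw [setIntegral_univ] at hspace
  rw [← hspace, integral_strip_eq_integral_integral hlhs, integral_strip_eq_integral_integral hrhs]
  refine setIntegral_congr_fun measurableSet_Ioc fun s hs => ?_
  have hs' : s ∈ Ioo 0 T := ⟨hτ.trans hs.1, hs.2.trans_lt ht⟩
  simp only [setIntegral_univ, hu.equation _ s hs']
  exact (integral_mul_laplacian_comm (hu.contDiff_log hs') hφ hφc).symm

lemma heaviside_log_sub_log (hu : IsClassicalSolution u T) (hv : IsClassicalSolution v T) {s : ℝ}
    (hs : s ∈ Ioo 0 T) (x : Plane) :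
    heaviside (Real.log (v x s) - Real.log (u x s)) = heaviside (v x s - u x s) := by
  simp only [heaviside, sub_pos, Real.log_lt_log_iff (hu.pos x s hs) (hv.pos x s hs)]

lemma laplacian_log_sub_log (hu : IsClassicalSolution u T) (hv : IsClassicalSolution v T) {s : ℝ}
    (hs : s ∈ Ioo 0 T) (x : Plane) :
    Δ (fun x => Real.log (v x s) - Real.log (u x s)) x =
      deriv (fun s => v x s) s - deriv (fun s => u x s) s := by
  rw [hu.equation x s hs, hv.equation x s hs]
  exact (hv.contDiff_log hs).contDiffAt.laplacian_sub (hu.contDiff_log hs).contDiffAt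

lemma integral_heaviside_mul_deriv_mul_le (hu : IsClassicalSolution u T)
    (hv : IsClassicalSolution v T) {s : ℝ} (hs : s ∈ Ioo 0 T) {H : Set Plane} (hH : IsOpen H)
    (hfr : ∀ x ∈ frontier H, v x s ≤ u x s) (hφ : ContDiff ℝ 2 φ) (hφc : HasCompactSupport φ)
    (hφ0 : ∀ x, 0 ≤ φ x) :
    ∫ x in H, heaviside (v x s - u x s) *
        (deriv (fun s => v x s) s - deriv (fun s => u x s) s) * φ x ≤
      ∫ x in H, max (Real.log (v x s) - Real.log (u x s)) 0 * Δ φ x := by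
  simpa only [heaviside_log_sub_log hu hv hs, laplacian_log_sub_log hu hv hs] using
    integral_heaviside_mul_laplacian_le hH ((hv.contDiff_log hs).sub (hu.contDiff_log hs))
      (fun x hx => sub_nonpos.2 (Real.log_le_log (hv.pos x s hs) (hfr x hx))) hφ hφc hφ0

lemma integrableOn_heaviside_mul_deriv_mul (hu : IsClassicalSolution u T)
    (hv : IsClassicalSolution v T) (hτ : 0 < τ) (ht : t < T) (hφ : Continuous φ)
    (hφc : HasCompactSupport φ) :
    IntegrableOn (fun p : Plane × ℝ => heaviside (v p.1 p.2 - u p.1 p.2) *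
      (deriv (fun s => v p.1 s) p.2 - deriv (fun s => u p.1 s) p.2) * φ p.1)
      (univ ×ˢ Ioc τ t) := by
  have hw : ContinuousOn (fun p : Plane × ℝ => v p.1 p.2 - u p.1 p.2) (univ ×ˢ Ioc τ t) :=
    (hv.continuousOn.sub hu.continuousOn).mono
      (prod_mono_right (Ioc_subset_Icc_self.trans (Icc_subset_Ioo hτ ht)))
  have hint := integrableOn_mul_strip
    ((hv.continuousOn_deriv_strip hτ ht).sub (hu.continuousOn_deriv_strip hτ ht)) hφ hφc
  simp only [mul_assoc]
  refine hint.bdd_mul (c := 1) (measurable_heaviside.comp_aemeasurable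
    (hw.aemeasurable (MeasurableSet.univ.prod measurableSet_Ioc))).aestronglyMeasurable
    (.of_forall fun p => abs_heaviside_le_one _)

lemma integrableOn_max_log_sub_log_mul (hu : IsClassicalSolution u T)
    (hv : IsClassicalSolution v T) (hτ : 0 < τ) (ht : t < T) (hφ : Continuous φ)
    (hφc : HasCompactSupport φ) :
    IntegrableOn (fun p : Plane × ℝ =>
      max (Real.log (v p.1 p.2) - Real.log (u p.1 p.2)) 0 * φ p.1) (univ ×ˢ Ioc τ t) :=
  integrableOn_mul_strip (((hv.continuousOn_log_strip hτ ht).sub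
    (hu.continuousOn_log_strip hτ ht)).sup continuousOn_const) hφ hφc

lemma integral_max_sub_zero_mul_le (hu : IsClassicalSolution u T) (hv : IsClassicalSolution v T)
    (hτ : 0 < τ) (hτt : τ ≤ t) (ht : t < T) {H : Set Plane} (hH : IsOpen H)
    (hfr : ∀ x ∈ frontier H, ∀ s ∈ Ioo 0 T, v x s ≤ u x s) (hφ : ContDiff ℝ 2 φ)
    (hφc : HasCompactSupport φ) (hφ0 : ∀ x, 0 ≤ φ x) :
    ∫ x in H, (max (v x t - u x t) 0 - max (v x τ - u x τ) 0) * φ x ≤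
      ∫ p in H ×ˢ Ioc τ t, max (Real.log (v p.1 p.2) - Real.log (u p.1 p.2)) 0 * Δ φ p.1 := by
  have hstrip : H ×ˢ Ioc τ t ⊆ univ ×ˢ Ioc τ t := prod_mono_left (subset_univ H)
  have hlhs := (integrableOn_heaviside_mul_deriv_mul hu hv hτ ht hφ.continuous hφc).mono_set hstrip
  have hrhs := (integrableOn_max_log_sub_log_mul hu hv hτ ht (continuous_laplacian hφ)
    (hasCompactSupport_laplacian hφc)).mono_set hstrip
  rw [← integral_strip_mul_eq_integral_sub_mul (w := fun x s => max (v x s - u x s) 0) hτt hlhs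
      fun x => integral_heaviside_mul_deriv hτt
        (fun s hs => (hv.hasDerivAt (Icc_subset_Ioo hτ ht hs) x).sub
          (hu.hasDerivAt (Icc_subset_Ioo hτ ht hs) x))
        ((hv.continuousOn_deriv_time hτ ht x).sub (hu.continuousOn_deriv_time hτ ht x)),
    integral_strip_eq_integral_integral hlhs, integral_strip_eq_integral_integral hrhs]
  rw [IntegrableOn, Measure.volume_eq_prod, ← Measure.prod_restrict] at hlhs hrhs
  refine setIntegral_mono_on hlhs.integral_prod_right hrhs.integral_prod_right measurableSet_Ioc
    fun s hs => ?_
  have hs' : s ∈ Ioo 0 T := ⟨hτ.trans hs.1, hs.2.trans_lt ht⟩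
  exact integral_heaviside_mul_deriv_mul_le hu hv hs' hH (fun x hx => hfr x hx s hs') hφ hφc hφ0

end IsClassicalSolution

end Solutions

/-! ### Consequences of the mass loss law -/

lemma continuous_log_mul_annulusWeight {a : ℝ} (ha : 0 ≤ a) :
    Continuous fun x => Real.log (‖x‖ ^ 2) * annulusWeight a x := by
  refine continuous_iff_continuousAt.2 fun x => ?_
  rcases eq_or_ne x 0 with rfl | hx
  · refine (continuousAt_const (y := (0 : ℝ))).congr
      (eventually_norm_le_one.mono fun y hy => ?_)
    simp only [annulusWeight_of_norm_le_one ha hy, mul_zero]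
  · exact (contDiffAt_log_norm_sq hx).continuousAt.mul (continuous_annulusWeight ha).continuousAt

lemma tendsto_integral_mul_cutoff {f : Plane → ℝ} {μ : Measure Plane} (hf : Integrable f μ) :
    Tendsto (fun N => ∫ x, f x * cutoff N x ∂μ) atTop (𝓝 (∫ x, f x ∂μ)) := by
  refine tendsto_integral_filter_of_dominated_convergence (fun x => |f x|) ?_ ?_ hf.abs
    (.of_forall fun x => ?_)
  · filter_upwards [eventually_gt_atTop 0] with N hN
    exact hf.1.mul (contDiff_cutoff hN.le).continuous.aestronglyMeasurable
  · filter_upwards [eventually_gt_atTop 0] with N hN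
    refine .of_forall fun x => ?_
    rw [norm_mul, Real.norm_eq_abs, Real.norm_eq_abs, abs_of_nonneg (cutoff_nonneg hN x)]
    exact mul_le_of_le_one_right (abs_nonneg _) (cutoff_le_one hN.le x)
  · simpa using (tendsto_cutoff x).const_mul (f x)

/-- `log (u(x,s) |x|²)`, which measures the deviation of `u` from the decay `|x|⁻²` at infinity. -/
noncomputable def logExcess (u : Plane → ℝ → ℝ) (p : Plane × ℝ) : ℝ :=
  Real.log (u p.1 p.2) + Real.log (‖p.1‖ ^ 2)

lemma exists_max_logExcess_mul_le : ∃ C, ∀ (u : Plane → ℝ → ℝ) (p : Plane × ℝ) (a : ℝ),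
    0 < u p.1 p.2 → max (logExcess u p) 0 * annulusWeight a p.1 ≤ C * u p.1 p.2 := by
  obtain ⟨C, hC⟩ := exists_annulusWeight_mul_norm_sq_le
  refine ⟨C, fun u p a hp => ?_⟩
  have hle : max (logExcess u p) 0 * annulusWeight a p.1 ≤
      u p.1 p.2 * ‖p.1‖ ^ 2 * annulusWeight a p.1 := by
    rcases eq_or_ne p.1 0 with h | h
    · simp [annulusWeight, h]
    · have hs : 0 < ‖p.1‖ ^ 2 := pow_pos (norm_pos_iff.2 h) 2
      refine mul_le_mul_of_nonneg_right (max_le ?_ (by positivity)) (annulusWeight_nonneg a _)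
      rw [logExcess, ← Real.log_mul hp.ne' hs.ne']
      linarith [Real.log_le_sub_one_of_pos (mul_pos hp hs)]
  calc max (logExcess u p) 0 * annulusWeight a p.1
      ≤ u p.1 p.2 * (annulusWeight a p.1 * ‖p.1‖ ^ 2) := hle.trans_eq (by ring)
    _ ≤ u p.1 p.2 * C := mul_le_mul_of_nonneg_left (hC a _) hp.le
    _ = C * u p.1 p.2 := mul_comm _ _

lemma max_log_sub_log_mul_laplacian_cutoff_le (u v : Plane → ℝ → ℝ) {N : ℝ} (hN : 0 < N)
    (p : Plane × ℝ) :
    max (Real.log (v p.1 p.2) - Real.log (u p.1 p.2)) 0 * Δ (cutoff N) p.1 ≤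
      (|logExcess u p| * annulusWeight N p.1 + |logExcess v p| * annulusWeight N p.1) / N := by
  have hmax : max (Real.log (v p.1 p.2) - Real.log (u p.1 p.2)) 0 ≤
      |logExcess u p| + |logExcess v p| := by
    refine max_le ?_ (by positivity)
    calc Real.log (v p.1 p.2) - Real.log (u p.1 p.2)
        = logExcess v p - logExcess u p := by simp only [logExcess]; ring
      _ ≤ |logExcess u p| + |logExcess v p| := by
        linarith [le_abs_self (logExcess v p), neg_abs_le (logExcess u p)]
  have hΔ : Δ (cutoff N) p.1 ≤ annulusWeight N p.1 / N := by
    rw [laplacian_cutoff hN.le]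
    gcongr
    exact sub_le_self _ (annulusWeight_nonneg 0 _)
  calc max (Real.log (v p.1 p.2) - Real.log (u p.1 p.2)) 0 * Δ (cutoff N) p.1
      ≤ max (Real.log (v p.1 p.2) - Real.log (u p.1 p.2)) 0 * (annulusWeight N p.1 / N) :=
        mul_le_mul_of_nonneg_left hΔ (le_max_right _ _)
    _ ≤ (|logExcess u p| + |logExcess v p|) * (annulusWeight N p.1 / N) :=
        mul_le_mul_of_nonneg_right hmax (div_nonneg (annulusWeight_nonneg _ _) hN.le)
    _ = _ := by ring

section MassLoss

variable {u v : Plane → ℝ → ℝ} {u₀ v₀ : Plane → ℝ} {T τ t : ℝ}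

namespace SatisfiesMassLoss

lemma integral_eq (hm : SatisfiesMassLoss u u₀ (fun _ => 2) T) (ht : t ∈ Ioo 0 T) :
    ∫ x, u x t = (∫ x, u₀ x) - 4 * Real.pi * t := by
  rw [(hm t ht).2, intervalIntegral.integral_const, smul_eq_mul]
  ring

lemma tendsto_integral_sub_mul_cutoff (hm : SatisfiesMassLoss u u₀ (fun _ => 2) T)
    (hτ : τ ∈ Ioo 0 T) (ht : t ∈ Ioo 0 T) :
    Tendsto (fun N => ∫ x, (u x t - u x τ) * cutoff N x) atTop
      (𝓝 (-(4 * Real.pi * (t - τ)))) := by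
  have hmass : ∫ x, (u x t - u x τ) = -(4 * Real.pi * (t - τ)) := by
    rw [integral_sub (hm t ht).1 (hm τ hτ).1, hm.integral_eq ht, hm.integral_eq hτ]
    ring
  exact hmass ▸ tendsto_integral_mul_cutoff ((hm t ht).1.sub (hm τ hτ).1)

end SatisfiesMassLoss

namespace IsClassicalSolution

lemma integrableOn_logExcess_mul_annulusWeight (hu : IsClassicalSolution u T) (hτ : 0 < τ)
    (ht : t < T) {a : ℝ} (ha : 0 ≤ a) :
    IntegrableOn (fun p => logExcess u p * annulusWeight a p.1) (univ ×ˢ Ioc τ t) := by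
  have hlogu := integrableOn_mul_strip (hu.continuousOn_log_strip hτ ht)
    (continuous_annulusWeight ha) (hasCompactSupport_annulusWeight a)
  have hlognorm := integrableOn_mul_strip (F := fun _ => 1) (a := τ) (b := t) continuousOn_const
    (continuous_log_mul_annulusWeight ha) (hasCompactSupport_annulusWeight a).mul_left
  exact (hlogu.add hlognorm).congr (.of_forall fun p => by simp [logExcess, add_mul])

lemma integral_logExcess_mul_laplacian_cutoff (hu : IsClassicalSolution u T) (hτ : 0 < τ)
    (hτt : τ ≤ t) (ht : t < T) {N : ℝ} (hN : 0 < N) :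
    ∫ p in univ ×ˢ Ioc τ t, logExcess u p * Δ (cutoff N) p.1 =
      (∫ x, (u x t - u x τ) * cutoff N x) + 4 * Real.pi * (t - τ) := by
  have hφ := contDiff_cutoff hN.le
  have hφc := hasCompactSupport_cutoff hN
  have hcont : Continuous fun x => Real.log (‖x‖ ^ 2) * Δ (cutoff N) x := by
    simp only [laplacian_cutoff hN.le, mul_div_assoc', mul_sub]
    exact ((continuous_log_mul_annulusWeight hN.le).sub
      (continuous_log_mul_annulusWeight le_rfl)).div_const N
  have hlogu := integrableOn_mul_strip (hu.continuousOn_log_strip hτ ht) (continuous_laplacian hφ)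
    (hasCompactSupport_laplacian hφc)
  have hlognorm := integrableOn_mul_strip (F := fun _ => 1) (a := τ) (b := t) continuousOn_const
    hcont (hasCompactSupport_laplacian hφc).mul_left
  have hflux : ∫ p in univ ×ˢ Ioc τ t, 1 * (Real.log (‖p.1‖ ^ 2) * Δ (cutoff N) p.1) =
      4 * Real.pi * (t - τ) := by
    rw [integral_strip_eq_integral_integral hlognorm]
    simp only [one_mul, setIntegral_univ, integral_log_mul_laplacian_cutoff hN]
    rw [setIntegral_const, smul_eq_mul, Real.volume_real_Ioc_of_le hτt, mul_comm]
  rw [hu.integral_sub_mul_eq_integral_log_mul_laplacian hτ hτt ht hφ hφc, ← hflux,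
    ← integral_add hlogu hlognorm]
  simp only [logExcess, add_mul, one_mul]

lemma tendsto_integral_logExcess_div (hu : IsClassicalSolution u T)
    (hm : SatisfiesMassLoss u u₀ (fun _ => 2) T) (hτ : 0 < τ) (hτt : τ ≤ t) (ht : t < T) :
    Tendsto (fun N => (∫ p in univ ×ˢ Ioc τ t, logExcess u p * annulusWeight N p.1) / N) atTop
      (𝓝 0) := by
  set I := ∫ p in univ ×ˢ Ioc τ t, logExcess u p * annulusWeight 0 p.1
  have hflux : Tendsto
      (fun N => (∫ x, (u x t - u x τ) * cutoff N x) + 4 * Real.pi * (t - τ)) atTop (𝓝 0) := by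
    simpa using (hm.tendsto_integral_sub_mul_cutoff ⟨hτ, hτt.trans_lt ht⟩
      ⟨hτ.trans_le hτt, ht⟩).add_const (4 * Real.pi * (t - τ))
  have hI : Tendsto (fun N => I / N) atTop (𝓝 0) := tendsto_const_nhds.div_atTop tendsto_id
  refine (add_zero (0 : ℝ) ▸ hflux.add hI).congr' ?_
  filter_upwards [eventually_gt_atTop 0] with N hN
  rw [← hu.integral_logExcess_mul_laplacian_cutoff hτ hτt ht hN, ← eq_sub_iff_add_eq, ← sub_div,
    ← integral_sub (hu.integrableOn_logExcess_mul_annulusWeight hτ ht hN.le)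
      (hu.integrableOn_logExcess_mul_annulusWeight hτ ht le_rfl), ← integral_div]
  simp only [laplacian_cutoff hN.le, mul_div_assoc', mul_sub]

lemma integrableOn_max_logExcess_mul_annulusWeight (hu : IsClassicalSolution u T) (hτ : 0 < τ)
    (ht : t < T) {a : ℝ} (ha : 0 ≤ a) :
    IntegrableOn (fun p => max (logExcess u p) 0 * annulusWeight a p.1) (univ ×ˢ Ioc τ t) :=
  (hu.integrableOn_logExcess_mul_annulusWeight hτ ht ha).pos_part.congr
    (.of_forall fun p => by simp [max_mul_of_nonneg _ _ (annulusWeight_nonneg a _)])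

lemma integrableOn_abs_logExcess_mul_annulusWeight (hu : IsClassicalSolution u T) (hτ : 0 < τ)
    (ht : t < T) {a : ℝ} (ha : 0 ≤ a) :
    IntegrableOn (fun p => |logExcess u p| * annulusWeight a p.1) (univ ×ˢ Ioc τ t) :=
  (hu.integrableOn_logExcess_mul_annulusWeight hτ ht ha).abs.congr
    (.of_forall fun p => by simp [abs_mul, abs_of_nonneg (annulusWeight_nonneg a _)])

lemma exists_integral_max_logExcess_le (hu : IsClassicalSolution u T)
    (hm : SatisfiesMassLoss u u₀ (fun _ => 2) T) (hτ : 0 < τ) (ht : t < T) :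
    ∃ K, ∀ a ≥ 0,
      ∫ p in univ ×ˢ Ioc τ t, max (logExcess u p) 0 * annulusWeight a p.1 ≤ K := by
  obtain ⟨C, hC⟩ := exists_max_logExcess_mul_le
  refine ⟨∫ s in Ioc τ t, C * ((∫ x, u₀ x) - 4 * Real.pi * s), fun a ha => ?_⟩
  have hint := hu.integrableOn_max_logExcess_mul_annulusWeight hτ ht ha
  rw [integral_strip_eq_integral_integral hint]
  rw [IntegrableOn, Measure.volume_eq_prod, ← Measure.prod_restrict] at hint
  refine setIntegral_mono_on hint.integral_prod_right
    (Continuous.integrableOn_Ioc (by fun_prop)) measurableSet_Ioc fun s hs => ?_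
  have hs' : s ∈ Ioo 0 T := ⟨hτ.trans hs.1, hs.2.trans_lt ht⟩
  rw [← hm.integral_eq hs', ← integral_const_mul, setIntegral_univ]
  exact integral_mono_of_nonneg
    (.of_forall fun x => mul_nonneg (le_max_right _ _) (annulusWeight_nonneg a x))
    ((hm s hs').1.const_mul C) (.of_forall fun x => hC u (x, s) a (hu.pos x s hs'))

-- The positive part of `logExcess u` is controlled by the mass of `u` since `log r ≤ r`; the
-- negative part is then controlled because the mass loss law makes the mean itself small.
lemma tendsto_integral_abs_logExcess_div (hu : IsClassicalSolution u T)
    (hm : SatisfiesMassLoss u u₀ (fun _ => 2) T) (hτ : 0 < τ) (hτt : τ ≤ t) (ht : t < T) :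
    Tendsto (fun N => (∫ p in univ ×ˢ Ioc τ t, |logExcess u p| * annulusWeight N p.1) / N) atTop
      (𝓝 0) := by
  obtain ⟨K, hK⟩ := hu.exists_integral_max_logExcess_le hm hτ ht
  have hbound : Tendsto (fun N => 2 * K / N -
      (∫ p in univ ×ˢ Ioc τ t, logExcess u p * annulusWeight N p.1) / N) atTop (𝓝 0) := by
    simpa using (tendsto_const_nhds.div_atTop tendsto_id).sub
      (hu.tendsto_integral_logExcess_div hm hτ hτt ht)
  have habs : ∀ r : ℝ, |r| = 2 * max r 0 - r := fun r => by
    rcases le_total r 0 with h | h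
    · rw [abs_of_nonpos h, max_eq_right h]; ring
    · rw [abs_of_nonneg h, max_eq_left h]; ring
  refine squeeze_zero' ?_ ?_ hbound
  · filter_upwards [eventually_gt_atTop 0] with N hN
    exact div_nonneg (integral_nonneg fun p =>
      mul_nonneg (abs_nonneg _) (annulusWeight_nonneg _ _)) hN.le
  · filter_upwards [eventually_gt_atTop 0] with N hN
    have hmax := hu.integrableOn_max_logExcess_mul_annulusWeight hτ ht hN.le
    have hint := hu.integrableOn_logExcess_mul_annulusWeight hτ ht hN.le
    simp only [habs, sub_mul, mul_assoc]
    rw [integral_sub (hmax.const_mul 2) hint, integral_const_mul, ← sub_div]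
    gcongr
    exact hK N hN.le

lemma integral_max_log_sub_log_mul_laplacian_cutoff_le (hu : IsClassicalSolution u T)
    (hv : IsClassicalSolution v T) (hτ : 0 < τ) (ht : t < T) {N : ℝ} (hN : 0 < N)
    {H : Set Plane} (hH : IsOpen H) :
    ∫ p in H ×ˢ Ioc τ t, max (Real.log (v p.1 p.2) - Real.log (u p.1 p.2)) 0 * Δ (cutoff N) p.1 ≤
      (∫ p in univ ×ˢ Ioc τ t, |logExcess u p| * annulusWeight N p.1) / N +
        (∫ p in univ ×ˢ Ioc τ t, |logExcess v p| * annulusWeight N p.1) / N := by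
  have hsub : H ×ˢ Ioc τ t ⊆ univ ×ˢ Ioc τ t := prod_mono_left (subset_univ H)
  have hleft := (hu.integrableOn_max_log_sub_log_mul hv hτ ht
    (continuous_laplacian (contDiff_cutoff hN.le))
    (hasCompactSupport_laplacian (hasCompactSupport_cutoff hN))).mono_set hsub
  have hintu := hu.integrableOn_abs_logExcess_mul_annulusWeight hτ ht hN.le
  have hintv := hv.integrableOn_abs_logExcess_mul_annulusWeight hτ ht hN.le
  have hright := (hintu.add hintv).div_const N
  rw [← add_div, ← integral_add hintu hintv, ← integral_div]
  refine (setIntegral_mono_on hleft (IntegrableOn.mono_set hright hsub)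
    (hH.measurableSet.prod measurableSet_Ioc)
    fun p _ => max_log_sub_log_mul_laplacian_cutoff_le u v hN p).trans
    (setIntegral_mono_set hright (.of_forall fun p => ?_) hsub.eventuallyLE)
  exact div_nonneg (add_nonneg (mul_nonneg (abs_nonneg _) (annulusWeight_nonneg _ _))
    (mul_nonneg (abs_nonneg _) (annulusWeight_nonneg _ _))) hN.le

theorem antitoneOn_integral_max_sub_zero (hu : IsClassicalSolution u T)
    (hv : IsClassicalSolution v T) (hmu : SatisfiesMassLoss u u₀ (fun _ => 2) T)
    (hmv : SatisfiesMassLoss v v₀ (fun _ => 2) T) {H : Set Plane} (hH : IsOpen H)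
    (hfr : ∀ x ∈ frontier H, ∀ s ∈ Ioo 0 T, v x s ≤ u x s) :
    AntitoneOn (fun s => ∫ x in H, max (v x s - u x s) 0) (Ioo 0 T) := by
  intro τ hτ t ht hτt
  have hint : ∀ s ∈ Ioo 0 T, IntegrableOn (fun x => max (v x s - u x s) 0) H := fun s hs =>
    ((hmv s hs).1.sub (hmu s hs).1).pos_part.integrableOn
  have hintt := hint t ht
  have hintτ := hint τ hτ
  have hlim := (hu.tendsto_integral_abs_logExcess_div hmu hτ.1 hτt ht.2).add
    (hv.tendsto_integral_abs_logExcess_div hmv hτ.1 hτt ht.2)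
  rw [add_zero] at hlim
  rw [← sub_nonpos]
  beta_reduce
  rw [← integral_sub hintt hintτ]
  refine le_of_tendsto_of_tendsto (tendsto_integral_mul_cutoff (hintt.sub hintτ)) hlim ?_
  filter_upwards [eventually_gt_atTop 0] with N hN
  exact (hu.integral_max_sub_zero_mul_le hv hτ.1 hτt ht.2 hH hfr (contDiff_cutoff hN.le)
    (hasCompactSupport_cutoff hN) (cutoff_nonneg hN)).trans
    (hu.integral_max_log_sub_log_mul_laplacian_cutoff_le hv hτ.1 ht.2 hN hH)

end IsClassicalSolution

end MassLoss

/-! ### The comparison principle -/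

section Measure

variable {α : Type*} [MeasurableSpace α] {μ : Measure α} {f g f₀ g₀ : α → ℝ}

lemma integral_abs_sub_le_of_integral_le (hf : Integrable f μ) (hg : Integrable g μ)
    (hf0 : 0 ≤ᵐ[μ] f) (hg0 : 0 ≤ᵐ[μ] g) (hle : ∫ x, f x ∂μ ≤ ∫ x, g x ∂μ) {K : Set α}
    (hK : MeasurableSet K) :
    ∫ x, |f x - g x| ∂μ ≤ 2 * ((∫ x in K, |f x - g x| ∂μ) + ∫ x in Kᶜ, g x ∂μ) := by
  have hd : Integrable (fun x => |f x - g x|) μ := (hf.sub hg).abs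
  have hfK : ∫ x in Kᶜ, f x ∂μ ≤ (∫ x in K, |f x - g x| ∂μ) + ∫ x in Kᶜ, g x ∂μ := by
    have hKle : ∫ x in K, g x - f x ∂μ ≤ ∫ x in K, |f x - g x| ∂μ :=
      integral_mono (hg.sub hf).integrableOn hd.integrableOn fun x =>
        abs_sub_comm (f x) (g x) ▸ le_abs_self _
    rw [integral_sub hg.integrableOn hf.integrableOn] at hKle
    linarith [integral_add_compl hK hf, integral_add_compl hK hg]
  calc ∫ x, |f x - g x| ∂μ
      = (∫ x in K, |f x - g x| ∂μ) + ∫ x in Kᶜ, |f x - g x| ∂μ := (integral_add_compl hK hd).symm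
    _ ≤ (∫ x in K, |f x - g x| ∂μ) + ∫ x in Kᶜ, f x + g x ∂μ := by
        refine add_le_add_right (setIntegral_mono_ae hd.integrableOn (hf.add hg).integrableOn ?_) _
        filter_upwards [hf0, hg0] with x (hfx : 0 ≤ f x) (hgx : 0 ≤ g x)
        exact (abs_sub_le_iff.2 ⟨by linarith, by linarith⟩ : |f x - g x| ≤ f x + g x)
    _ ≤ 2 * ((∫ x in K, |f x - g x| ∂μ) + ∫ x in Kᶜ, g x ∂μ) := by
        rw [integral_add hf.integrableOn hg.integrableOn]
        linarith

lemma setIntegral_max_sub_zero_le (hf : Integrable f μ) (hg : Integrable g μ)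
    (hf₀ : Integrable f₀ μ) (hg₀ : Integrable g₀ μ) {H : Set α} (hH : MeasurableSet H)
    (hle : ∀ᵐ x ∂μ, x ∈ H → g₀ x ≤ f₀ x) :
    ∫ x in H, max (g x - f x) 0 ∂μ ≤ (∫ x, |f x - f₀ x| ∂μ) + ∫ x, |g x - g₀ x| ∂μ := by
  have hdf := (hf.sub hf₀).abs
  have hdg := (hg.sub hg₀).abs
  calc ∫ x in H, max (g x - f x) 0 ∂μ
      ≤ ∫ x in H, |f x - f₀ x| + |g x - g₀ x| ∂μ := by
        refine setIntegral_mono_on_ae (hg.sub hf).pos_part.integrableOn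
          (hdf.add hdg).integrableOn hH (hle.mono fun x hx hxH => max_le ?_ (by positivity))
        linarith [hx hxH, le_abs_self (g x - g₀ x), neg_abs_le (f x - f₀ x)]
    _ ≤ ∫ x, |f x - f₀ x| + |g x - g₀ x| ∂μ :=
        setIntegral_le_integral (hdf.add hdg) (.of_forall fun x => by positivity)
    _ = _ := integral_add hdf hdg

lemma le_on_open_of_setIntegral_max_sub_zero_nonpos [TopologicalSpace α]
    [OpensMeasurableSpace α] [μ.IsOpenPosMeasure] (hf : Continuous f) (hg : Continuous g)
    {H : Set α} (hH : IsOpen H) (hint : IntegrableOn (fun x => max (g x - f x) 0) H μ)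
    (hle : ∫ x in H, max (g x - f x) 0 ∂μ ≤ 0) : ∀ x ∈ H, g x ≤ f x := by
  have hnonneg : ∀ x, 0 ≤ max (g x - f x) 0 := fun x => le_max_right _ _
  have hae := (setIntegral_eq_zero_iff_of_nonneg_ae (.of_forall hnonneg) hint).1
    (hle.antisymm (integral_nonneg hnonneg))
  intro x hx
  exact sub_nonpos.1 (max_eq_right_iff.1 (Measure.eqOn_open_of_ae_eq hae hH
    ((hg.sub hf).max continuous_const).continuousOn continuousOn_const hx))

end Measure

section Comparison

variable {u v : Plane → ℝ → ℝ} {u₀ v₀ : Plane → ℝ} {T : ℝ}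

namespace HasInitialValue

lemma tendsto_setIntegral_abs_sub (h0 : HasInitialValue u u₀) (hT : 0 < T)
    (hint : ∀ t ∈ Ioo 0 T, Integrable fun x => u x t) (hu₀ : Integrable u₀) {K : Set Plane}
    (hK : IsCompact K) :
    Tendsto (fun t => ∫ x in K, |u x t - u₀ x|) (𝓝[>] 0) (𝓝 0) := by
  refine ((ENNReal.tendsto_toReal ENNReal.zero_ne_top).comp (h0 K hK)).congr' ?_
  filter_upwards [Ioo_mem_nhdsGT hT] with t ht
  simp only [Function.comp_apply, eLpNorm_one_eq_lintegral_enorm]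
  exact (integral_norm_eq_lintegral_enorm ((hint t ht).sub hu₀).integrableOn.1).symm

theorem tendsto_integral_abs_sub (h0 : HasInitialValue u u₀) (hu : IsClassicalSolution u T)
    (hm : SatisfiesMassLoss u u₀ (fun _ => 2) T) (hT : 0 < T) (hu₀ : Integrable u₀)
    (hnonneg : 0 ≤ᵐ[volume] u₀) :
    Tendsto (fun t => ∫ x, |u x t - u₀ x|) (𝓝[>] 0) (𝓝 0) := by
  have htail : Tendsto (fun R => ∫ x in (Metric.closedBall (0 : Plane) R)ᶜ, u₀ x) atTop (𝓝 0) := by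
    have hcover := aecover_closedBall (μ := volume) (x := (0 : Plane)) tendsto_id
    simpa only [setIntegral_compl Metric.isClosed_closedBall.measurableSet hu₀, sub_self,
      id_eq] using
      (hcover.integral_tendsto_of_countably_generated hu₀).const_sub (∫ x, u₀ x)
  refine Metric.tendsto_nhds.2 fun ε hε => ?_
  obtain ⟨R, hR⟩ := (htail.eventually_lt_const (by linarith : 0 < ε / 4)).exists
  filter_upwards [Ioo_mem_nhdsGT hT, (h0.tendsto_setIntegral_abs_sub hT (fun t ht => (hm t ht).1)
    hu₀ (isCompact_closedBall 0 R)).eventually_lt_const (by linarith : 0 < ε / 4)] with t ht hloc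
  have hmass : ∫ x, u x t ≤ ∫ x, u₀ x := by
    have := mul_pos Real.pi_pos ht.1
    rw [hm.integral_eq ht]
    linarith
  have hle := integral_abs_sub_le_of_integral_le (hm t ht).1 hu₀
    (.of_forall fun x => (hu.pos x t ht).le) hnonneg hmass
    (Metric.isClosed_closedBall (x := 0) (ε := R)).measurableSet
  rw [Real.dist_eq, sub_zero, abs_of_nonneg (integral_nonneg fun x => abs_nonneg _)]
  linarith

end HasInitialValue

theorem IsClassicalSolution.le_of_initial_le (hu : IsClassicalSolution u T)
    (hv : IsClassicalSolution v T) (hmu : SatisfiesMassLoss u u₀ (fun _ => 2) T)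
    (hmv : SatisfiesMassLoss v v₀ (fun _ => 2) T) (h0u : HasInitialValue u u₀)
    (h0v : HasInitialValue v v₀) (hu₀ : Integrable u₀) (hv₀ : Integrable v₀)
    (hu₀_nonneg : 0 ≤ᵐ[volume] u₀) (hv₀_nonneg : 0 ≤ᵐ[volume] v₀) {H : Set Plane} (hH : IsOpen H)
    (hfr : ∀ x ∈ frontier H, ∀ s ∈ Ioo 0 T, v x s ≤ u x s)
    (hinit : ∀ᵐ x, x ∈ H → v₀ x ≤ u₀ x) {t : ℝ} (ht : t ∈ Ioo 0 T) :
    ∀ x ∈ H, v x t ≤ u x t := by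
  have hT : 0 < T := ht.1.trans ht.2
  have hlim := (h0u.tendsto_integral_abs_sub hu hmu hT hu₀ hu₀_nonneg).add
    (h0v.tendsto_integral_abs_sub hv hmv hT hv₀ hv₀_nonneg)
  rw [add_zero] at hlim
  refine le_on_open_of_setIntegral_max_sub_zero_nonpos (μ := volume)
    (hu.contDiff_space t ht).continuous (hv.contDiff_space t ht).continuous hH
    ((hmv t ht).1.sub (hmu t ht).1).pos_part.integrableOn (ge_of_tendsto hlim ?_)
  filter_upwards [Ioo_mem_nhdsGT ht.1] with τ hτ
  have hτT : τ ∈ Ioo 0 T := ⟨hτ.1, hτ.2.trans ht.2⟩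
  calc ∫ x in H, max (v x t - u x t) 0
      ≤ ∫ x in H, max (v x τ - u x τ) 0 :=
        hu.antitoneOn_integral_max_sub_zero hv hmu hmv hH hfr hτT ht hτ.2.le
    _ ≤ (∫ x, |u x τ - u₀ x|) + ∫ x, |v x τ - v₀ x| :=
        setIntegral_max_sub_zero_le (hmu τ hτT).1 (hmv τ hτT).1 hu₀ hv₀ hH.measurableSet hinit

end Comparison

/-! ### Reflection in a perpendicular bisector -/

section Reflection

variable {E : Type*} [NormedAddCommGroup E] [InnerProductSpace ℝ E]

lemma inner_sub_midpoint (x y z : E) :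
    inner ℝ (y - x) (z - midpoint ℝ x y) = (dist z x ^ 2 - dist z y ^ 2) / 2 := by
  have hx : dist z x ^ 2 = inner ℝ (z - x) (z - x) := by
    rw [real_inner_self_eq_norm_sq, dist_eq_norm]
  have hy : dist z y ^ 2 = inner ℝ (z - y) (z - y) := by
    rw [real_inner_self_eq_norm_sq, dist_eq_norm]
  rw [hx, hy, midpoint_eq_smul_add, invOf_eq_inv]
  simp only [inner_sub_left, inner_sub_right, inner_add_right, inner_smul_right,
    real_inner_comm x, real_inner_comm y z]
  ring

instance nonempty_perpBisector (x y : E) : Nonempty (AffineSubspace.perpBisector x y) :=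
  AffineSubspace.perpBisector_nonempty.to_subtype

variable [FiniteDimensional ℝ E] {x y z : E}

/-- The reflection that swaps `x` and `y` and fixes the points equidistant from them. -/
noncomputable def bisectorReflection (x y : E) : E ≃ᵃⁱ[ℝ] E :=
  EuclideanGeometry.reflection (AffineSubspace.perpBisector x y)

lemma bisectorReflection_of_dist_eq (h : dist z x = dist z y) : bisectorReflection x y z = z :=
  (EuclideanGeometry.reflection_eq_self_iff z).2 (AffineSubspace.mem_perpBisector_iff_dist_eq.2 h)

lemma bisectorReflection_apply (x y z : E) :
    bisectorReflection x y z = z + ((dist z y ^ 2 - dist z x ^ 2) / ‖y - x‖ ^ 2) • (y - x) := by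
  rw [bisectorReflection, EuclideanGeometry.reflection_apply_of_mem _ _
    (AffineSubspace.midpoint_mem_perpBisector x y)]
  simp only [AffineSubspace.direction_perpBisector, vsub_eq_sub, vadd_eq_add]
  rw [Submodule.reflection_orthogonal_apply, Submodule.reflection_singleton_apply,
    inner_sub_midpoint]
  simp only [RCLike.ofReal_real_eq_id, id_eq]
  module

lemma bisectorReflection_left (x y : E) : bisectorReflection x y x = y := by
  rcases eq_or_ne x y with rfl | h
  · exact bisectorReflection_of_dist_eq rfl
  · have hn : ‖y - x‖ ^ 2 ≠ 0 := pow_ne_zero 2 (norm_ne_zero_iff.2 (sub_ne_zero.2 h.symm))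
    rw [bisectorReflection_apply, dist_self, dist_eq_norm', zero_pow two_ne_zero, sub_zero,
      div_self hn, one_smul, add_sub_cancel]

lemma norm_bisectorReflection_sq (x y z : E) :
    ‖bisectorReflection x y z‖ ^ 2 = ‖z‖ ^ 2 +
      (dist z y ^ 2 - dist z x ^ 2) / ‖y - x‖ ^ 2 * (‖y‖ ^ 2 - ‖x‖ ^ 2) := by
  set k := (dist z y ^ 2 - dist z x ^ 2) / ‖y - x‖ ^ 2 with hk
  have hkk : k * (k * ‖y - x‖ ^ 2) = k * (dist z y ^ 2 - dist z x ^ 2) := by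
    rcases eq_or_ne (‖y - x‖ ^ 2) 0 with h | h
    · simp [hk, h]
    · rw [hk, div_mul_cancel₀ _ h]
  have hinner : inner ℝ z (y - x) =
      (dist z x ^ 2 - dist z y ^ 2 + (‖y‖ ^ 2 - ‖x‖ ^ 2)) / 2 := by
    have hz := inner_sub_midpoint x y z
    have h0 := inner_sub_midpoint x y 0
    rw [inner_sub_right] at hz h0
    rw [inner_zero_right, dist_zero_left, dist_zero_left] at h0
    rw [real_inner_comm]
    linarith
  rw [bisectorReflection_apply, ← hk, norm_add_sq_real, inner_smul_right, norm_smul, mul_pow,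
    Real.norm_eq_abs, sq_abs, hinner]
  linear_combination hkk

lemma norm_le_norm_bisectorReflection (hxy : ‖x‖ ≤ ‖y‖) (hz : dist z x ≤ dist z y) :
    ‖z‖ ≤ ‖bisectorReflection x y z‖ := by
  refine le_of_sq_le_sq ?_ (norm_nonneg _)
  rw [norm_bisectorReflection_sq]
  refine le_add_of_nonneg_right (mul_nonneg (div_nonneg ?_ (by positivity)) ?_) <;>
  · rw [sub_nonneg]
    gcongr

lemma le_norm_bisectorReflection {r : ℝ} (hxy : ‖x‖ + 2 * r ≤ ‖y‖) (hz : dist z x ≤ dist z y) :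
    r ≤ ‖bisectorReflection x y z‖ := by
  set σ := bisectorReflection x y with hσ
  have hσx : dist (σ z) y = dist z x := by
    rw [← bisectorReflection_left x y, σ.dist_map]
  have hσy : dist (σ z) x = dist z y := by
    rw [hσ, bisectorReflection, ← EuclideanGeometry.dist_reflection, ← bisectorReflection,
      bisectorReflection_left]
  have hy : ‖y‖ ≤ ‖σ z‖ + dist (σ z) y := by
    simpa only [dist_zero_left] using dist_triangle 0 (σ z) y
  have hx : dist (σ z) x ≤ ‖σ z‖ + ‖x‖ := dist_le_norm_add_norm _ _
  linarith

end Reflection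

section Plane

variable {u : Plane → ℝ → ℝ} {u₀ : Plane → ℝ} {T : ℝ}

lemma measurePreserving_affineIsometryEquiv {E : Type*} [NormedAddCommGroup E]
    [InnerProductSpace ℝ E] [FiniteDimensional ℝ E] [MeasurableSpace E] [BorelSpace E]
    (g : E ≃ᵃⁱ[ℝ] E) : MeasurePreserving g volume volume := by
  have h := (measurePreserving_add_right volume (g 0)).comp
    g.linearIsometryEquiv.measurePreserving
  exact (funext (affineIsometryEquiv_apply g) : ⇑g = (· + g 0) ∘ g.linearIsometryEquiv) ▸ h

lemma measurableEmbedding_affineIsometryEquiv {E : Type*} [NormedAddCommGroup E]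
    [NormedSpace ℝ E] [MeasurableSpace E] [BorelSpace E] (g : E ≃ᵃⁱ[ℝ] E) :
    MeasurableEmbedding g :=
  g.toHomeomorph.measurableEmbedding

lemma SatisfiesMassLoss.comp_affineIsometryEquiv {f : ℝ → ℝ} (hm : SatisfiesMassLoss u u₀ f T)
    (g : Plane ≃ᵃⁱ[ℝ] Plane) :
    SatisfiesMassLoss (fun x t => u (g x) t) (fun x => u₀ (g x)) f T := by
  have hg := measurePreserving_affineIsometryEquiv g
  have hge := measurableEmbedding_affineIsometryEquiv g
  refine fun t ht => ⟨(hg.integrable_comp_emb hge).2 (hm t ht).1, ?_⟩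
  rw [hg.integral_comp hge fun x => u x t, hg.integral_comp hge u₀, (hm t ht).2]

lemma HasInitialValue.comp_affineIsometryEquiv (h0 : HasInitialValue u u₀)
    (g : Plane ≃ᵃⁱ[ℝ] Plane) : HasInitialValue (fun x t => u (g x) t) fun x => u₀ (g x) := by
  intro K hK
  have hg := measurePreserving_affineIsometryEquiv g
  have hge := measurableEmbedding_affineIsometryEquiv g
  refine (h0 (g '' K) (hK.image g.continuous)).congr fun t => ?_
  rw [← (hg.restrict_image_emb hge K).map_eq, hge.eLpNorm_map_measure]
  rfl

end Plane

section Comparison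

variable {u₀ : Plane → ℝ} {r₁ r₂ : ℝ}

lemma IsRadialDecreasingFrom.ae_le_essSup (h : IsRadialDecreasingFrom u₀ r₁) (hr : r₁ ≤ r₂) :
    ∀ᵐ z, r₂ ≤ ‖z‖ → u₀ z ≤ essSup u₀ (volume.restrict (Metric.ball (0 : Plane) r₂)ᶜ) := by
  obtain ⟨φ, hφ, hu₀⟩ := h
  have hbdd : ∀ᵐ z ∂volume.restrict (Metric.ball (0 : Plane) r₂)ᶜ, u₀ z ≤ φ r₁ := by
    refine ae_restrict_of_forall_mem Metric.isOpen_ball.measurableSet.compl fun z hz => ?_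
    have hz' : r₁ ≤ ‖z‖ := hr.trans (by simpa using hz)
    rw [hu₀ z hz']
    exact hφ self_mem_Ici hz' hz'
  have hae := (ae_restrict_iff' Metric.isOpen_ball.measurableSet.compl).1
    (_root_.ae_le_essSup (isBoundedUnder_of_eventually_le hbdd))
  filter_upwards [hae] with z hz hzr
  exact hz (by simpa using hzr)

lemma ae_essInf_closedBall_le (h : 0 ≤ᵐ[volume] u₀) (r : ℝ) :
    ∀ᵐ z, ‖z‖ ≤ r → essInf u₀ (volume.restrict (Metric.closedBall (0 : Plane) r)) ≤ u₀ z := by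
  have hae := (ae_restrict_iff' Metric.isClosed_closedBall.measurableSet).1
    (ae_essInf_le (isBoundedUnder_of_eventually_ge
      (ae_restrict_of_ae (s := Metric.closedBall (0 : Plane) r) h)))
  filter_upwards [hae] with z hz hzr
  exact hz (by simpa using hzr)

variable {x y : Plane}

lemma IsRadialDecreasingFrom.ae_comp_bisectorReflection_le (h : IsRadialDecreasingFrom u₀ r₁)
    (hu₀_nonneg : 0 ≤ᵐ[volume] u₀) (hr₁₂ : r₁ ≤ r₂) (hr₂ : 0 ≤ r₂)
    (hess : essSup u₀ (volume.restrict (Metric.ball (0 : Plane) r₂)ᶜ) ≤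
      essInf u₀ (volume.restrict (Metric.closedBall (0 : Plane) r₁)))
    (hxy : ‖x‖ + 2 * r₂ ≤ ‖y‖) :
    ∀ᵐ z, dist z x ≤ dist z y → u₀ (bisectorReflection x y z) ≤ u₀ z := by
  filter_upwards [ae_essInf_closedBall_le hu₀_nonneg r₁,
    (measurePreserving_affineIsometryEquiv (bisectorReflection x y)).quasiMeasurePreserving.ae
      (h.ae_le_essSup hr₁₂)] with z hinf hsup hz
  rcases le_total r₁ ‖z‖ with hrz | hzr
  · obtain ⟨φ, hφ, hu₀⟩ := h
    have hle : ‖z‖ ≤ ‖bisectorReflection x y z‖ :=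
      norm_le_norm_bisectorReflection (by linarith) hz
    rw [hu₀ z hrz, hu₀ _ (hrz.trans hle)]
    exact hφ hrz (hrz.trans hle) hle
  · exact (hsup (le_norm_bisectorReflection hxy hz)).trans (hess.trans (hinf hzr))

lemma IsClassicalSolution.le_of_ae_comp_bisectorReflection_le {u : Plane → ℝ → ℝ} {T t : ℝ}
    (hu : IsClassicalSolution u T) (hu_initial : HasInitialValue u u₀)
    (hu_mass : SatisfiesMassLoss u u₀ (fun _ => 2) T)
    (hu₀ : Integrable u₀) (hu₀_nonneg : 0 ≤ᵐ[volume] u₀)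
    (hrefl : ∀ᵐ z, dist z x ≤ dist z y → u₀ (bisectorReflection x y z) ≤ u₀ z)
    (ht : t ∈ Ioo 0 T) : u y t ≤ u x t := by
  rcases eq_or_ne x y with rfl | hxy
  · exact le_rfl
  set σ := bisectorReflection x y with hσ
  have hσm := measurePreserving_affineIsometryEquiv σ
  have hle := IsClassicalSolution.le_of_initial_le (H := {z | dist z x < dist z y})
    hu (hu.comp_affineIsometryEquiv σ) hu_mass (hu_mass.comp_affineIsometryEquiv σ)
    hu_initial (hu_initial.comp_affineIsometryEquiv σ) hu₀
    ((hσm.integrable_comp_emb (measurableEmbedding_affineIsometryEquiv σ)).2 hu₀)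
    hu₀_nonneg (hσm.quasiMeasurePreserving.ae hu₀_nonneg)
    (isOpen_lt (by fun_prop) (by fun_prop))
    (fun z hz s _ => by
      have hz' : dist z x = dist z y := frontier_lt_subset_eq (by fun_prop) (by fun_prop) hz
      rw [hσ, bisectorReflection_of_dist_eq hz'])
    (hrefl.mono fun z hz hzH => hz (le_of_lt hzH)) ht x (by simpa using hxy)
  simpa only [hσ, bisectorReflection_left] using hle

end Comparison

lemma exists_mem_closedBall_forall_le {E : Type*} [NormedAddCommGroup E] [ProperSpace E]
    {f : E → ℝ} {R : ℝ} (hf : Continuous f) (hR : 0 ≤ R)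
    (h : ∀ y, R ≤ ‖y‖ → f y ≤ f 0) : ∃ z ∈ Metric.closedBall (0 : E) R, ∀ x, f x ≤ f z := by
  have h0 : (0 : E) ∈ Metric.closedBall 0 R := Metric.mem_closedBall_self hR
  obtain ⟨z, hz, hmax⟩ := (isCompact_closedBall (0 : E) R).exists_isMaxOn ⟨0, h0⟩ hf.continuousOn
  refine ⟨z, hz, fun x => ?_⟩
  rcases le_total ‖x‖ R with hx | hx
  · exact hmax (by simpa using hx)
  · exact (h x hx).trans (hmax h0)

end LogDiffusion

open LogDiffusion in
theorem lemma1p1_general {u₀ : Plane → ℝ} {u : Plane → ℝ → ℝ} {r₁ r₂ T : ℝ}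
    (hr₁₂ : r₁ ≤ r₂) (hr₂ : 0 ≤ r₂)
    (hu₀_nonneg : 0 ≤ᵐ[volume] u₀) (hu₀ : Integrable u₀)
    (hu₀_radial : IsRadialDecreasingFrom u₀ r₁)
    (hu₀_ess : essSup u₀ (volume.restrict (Metric.ball (0 : Plane) r₂)ᶜ) ≤
      essInf u₀ (volume.restrict (Metric.closedBall (0 : Plane) r₁)))
    (hu : IsClassicalSolution u T) (hu_initial : HasInitialValue u u₀)
    (hu_mass : SatisfiesMassLoss u u₀ (fun _ => 2) T) :
    (∀ t ∈ Ioo (0 : ℝ) T, ∀ x y : Plane, ‖x‖ + 2 * r₂ ≤ ‖y‖ → u y t ≤ u x t) ∧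
    (∀ t ∈ Ioo (0 : ℝ) T, ∃ z ∈ Metric.closedBall (0 : Plane) (2 * r₂),
      ∀ x : Plane, u x t ≤ u z t) := by
  have hle : ∀ t ∈ Ioo (0 : ℝ) T, ∀ x y : Plane, ‖x‖ + 2 * r₂ ≤ ‖y‖ → u y t ≤ u x t :=
    fun t ht x y hxy => hu.le_of_ae_comp_bisectorReflection_le hu_initial hu_mass hu₀ hu₀_nonneg
      (hu₀_radial.ae_comp_bisectorReflection_le hu₀_nonneg hr₁₂ hr₂ hu₀_ess hxy) ht
  refine ⟨hle, fun t ht => ?_⟩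
  refine exists_mem_closedBall_forall_le (hu.contDiff_space t ht).continuous (by positivity) ?_
  exact fun y hy => hle t ht 0 y (by simpa using hy)

theorem lemma1p1 (u₀ : LogDiffusion.Plane → ℝ) (u : LogDiffusion.Plane → ℝ → ℝ) (r₁ r₂ T : ℝ)
    (hr₁ : 0 < r₁) (hr₁₂ : r₁ < r₂)
    (hu₀_nonneg : 0 ≤ᵐ[volume] u₀) (hu₀_L1 : MemLp u₀ 1 volume) (hu₀_Linfty : MemLp u₀ ⊤ volume)
    (hu₀_radial : LogDiffusion.IsRadialDecreasingFrom u₀ r₁)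
    (hu₀_ess : essSup u₀ (volume.restrict (Metric.ball (0 : LogDiffusion.Plane) r₂)ᶜ) ≤
      essInf u₀ (volume.restrict (Metric.closedBall (0 : LogDiffusion.Plane) r₁)))
    (hu : LogDiffusion.IsMaximalSolution u u₀ T) :
    (∀ t ∈ Ioo (0 : ℝ) T, ∀ x y : LogDiffusion.Plane, ‖x‖ + 2 * r₂ ≤ ‖y‖ → u y t ≤ u x t) ∧
    (∀ t ∈ Ioo (0 : ℝ) T, ∃ z ∈ Metric.closedBall (0 : LogDiffusion.Plane) (2 * r₂),
      ∀ x : LogDiffusion.Plane, u x t ≤ u z t) := by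
  exact lemma1p1_general hr₁₂.le (hr₁.trans hr₁₂).le hu₀_nonneg
    (memLp_one_iff_integrable.1 hu₀_L1) hu₀_radial hu₀_ess hu.classical hu.initial hu.massLoss
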